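/- Let $d\ge 1$, $|x|_\infty=\max_t|x_t|$ on $\mathbb Z^d$, and let all matrices $A=(a(i,j))_{i,j\in\mathbb Z^d}$ and sequences $c=(c(i))_{i\in\mathbb Z^d}$ be complex valued, with $(Ac)(i)=\sum_{j}a(i,j)c(j)$. A weight matrix is $u=(u(i,j))_{i,j\in\mathbb Z^d}$ with $u(i,j)\ge 1$ for all $i,j$. For $1\le p\le\infty$, $\mathcal B_{p,u}$ is the class of matrices $A$ with $$\Big\|\Big(\sup_{|i-j|_\infty\ge|k|_\infty}|a(i,j)|u(i,j)\Big)_{k\in\mathbb Z^d}\Big\|_{\ell^p}<\infty ,$$ and $\mathcal B=\mathcal B_{1,u_0}$ with $u_0\equiv 1$. The weight matrix $u$ is $p$-submultiplicative if there is a weight matrix $v$ with $u(i,j)\le u(i,k)v(k,j)+v(i,k)u(k,j)$ for all $i,j,k$ and $$\Big\|\Big(\sup_{|i-j|_\infty\ge|k|_\infty}v(i,j)u(i,j)^{-1}\Big)_{k\in\mathbb Z^d}\Big\|_{\ell^{p/(p-1)}}<\infty .$$ (Thus $u_0$ is $1$-submultiplicative.) A positive sequence $w$ on $\mathbb Z^d$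 is a discrete $A_q$-weight if there is $C>0$ such that for all cubes $Q=a+[0,N-1]^d$, $a\in\mathbb Z^d$, $N\ge1$, $$\Big(N^{-d}\sum_{i\in Q}w(i)\Big)\Big(N^{-d}\sum_{i\in Q}w(i)^{-1/(q-1)}\Big)^{q-1}\le C\quad\text{if }1<q<\infty,$$ $$N^{-d}\sum_{i\in Q}w(i)\le C\min_{i\in Q}w(i)\quad\text{if }q=1.$$ Put $\|c\|_{q,w}=\big(\sum_i|c(i)|^qw(i)\big)^{1/q}$ and $\ell^q_w=\{c:\|c\|_{q,w}<\infty\}$. The matrix $A$ has $\ell^q_w$-stability if there is $C>0$ such that, for every $c\in\ell^q_w$, the series defining $Ac$ converge absolutely and $C^{-1}\|c\|_{q,w}\le\|Ac\|_{q,w}\le C\|c\|_{q,w}$. **Theorem.** Let $1\le p\le\infty$, let $u$ be a $p$-submultiplicative weight matrix and let $A\in\mathcal B_{p,u}$ (in particular, $A$ may be any element of $\mathcal B$). Suppose that $A$ has $\ell^q_w$-stability for some $1\le q<\infty$ and some discrete $A_q$-weight $w$. Then: 1. $A$ has $\ell^{q'}_{w'}$-stability for every $1\le q'<\infty$ and every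 discrete $A_{q'}$-weight $w'$. 2. There is a nonnegative summable sequence $g$ on $\mathbb Z^d$ that is radially decreasing ($g(j)\le g(i)$ whenever $|i|_\infty\le|j|_\infty$) such that for every bounded sequence $c$ the series below converge absolutely and $$|c(i)|\le\sum_{j\in\mathbb Z^d}g(i-j)\,|(Ac)(j)|\qquad(i\in\mathbb Z^d),$$ where the series defining $Ac$ also converge absolutely. -/

import Mathlib

open scoped ENNReal NNReal

noncomputable section

namespace BeurlingStability

/-- The lattice `ℤ^d`. Its norm `‖x‖` is the sup norm `max (|x 1|, …, |x d|)`. -/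
abbrev Lat (d : ℕ) : Type := Fin d → ℤ

/-- Infinite complex matrices `(a(i,j))` indexed by `ℤ^d × ℤ^d`. -/
abbrev InfMatrix (d : ℕ) : Type := Lat d → Lat d → ℂ

/-- The product of a matrix and a sequence, `(Ac)(i) = ∑_j a(i,j) c(j)`. -/
def mulSeq {d : ℕ} (A : InfMatrix d) (c : Lat d → ℂ) : Lat d → ℂ :=
  fun i => ∑' j, A i j * c j

/-- The `ℓ^p`-norm, `1 ≤ p ≤ ∞`, of an extended nonnegative sequence on `ℤ^d`. -/
def lpNorm {d : ℕ} (p : ℝ≥0∞) (f : Lat d → ℝ≥0∞) : ℝ≥0∞ :=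
  if p = ∞ then ⨆ k, f k else (∑' k, f k ^ p.toReal) ^ (1 / p.toReal)

/-- The sequence `k ↦ sup_{|i-j| ≥ |k|} f(i,j)`. -/
def radialSup {d : ℕ} (f : Lat d → Lat d → ℝ≥0∞) : Lat d → ℝ≥0∞ :=
  fun k => ⨆ (i : Lat d) (j : Lat d) (_ : ‖k‖ ≤ ‖i - j‖), f i j

/-- A weight matrix: all entries are at least one. -/
def IsWeightMatrix {d : ℕ} (u : Lat d → Lat d → ℝ) : Prop :=
  ∀ i j, 1 ≤ u i j

/-- The norm of the class `𝓑_{p,u}`: the `ℓ^p`-norm of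
`k ↦ sup_{|i-j| ≥ |k|} |a(i,j)| u(i,j)`. -/
def beurlingNorm {d : ℕ} (p : ℝ≥0∞) (u : Lat d → Lat d → ℝ) (A : InfMatrix d) : ℝ≥0∞ :=
  lpNorm p (radialSup fun i j => ENNReal.ofReal (‖A i j‖ * u i j))

/-- The class `𝓑_{p,u}`. -/
def beurlingClass {d : ℕ} (p : ℝ≥0∞) (u : Lat d → Lat d → ℝ) : Set (InfMatrix d) :=
  {A | beurlingNorm p u A < ∞}

/-- `v` is a companion weight matrix of `u`. Here `p.conjExponent` is `p/(p-1)`, which is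
`∞` for `p = 1` and `1` for `p = ∞`. -/
structure IsCompanion {d : ℕ} (p : ℝ≥0∞) (u v : Lat d → Lat d → ℝ) : Prop where
  weight : IsWeightMatrix v
  le_add : ∀ i j k, u i j ≤ u i k * v k j + v i k * u k j
  norm_lt_top :
    lpNorm p.conjExponent (radialSup fun i j => ENNReal.ofReal (v i j * (u i j)⁻¹)) < ∞

/-- A `p`-submultiplicative weight matrix. -/
def IsSubmultiplicative {d : ℕ} (p : ℝ≥0∞) (u : Lat d → Lat d → ℝ) : Prop :=
  IsWeightMatrix u ∧ ∃ v, IsCompanion p u v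

/-- The cube `a + [0, N-1]^d` in `ℤ^d`. -/
def cube {d : ℕ} (a : Lat d) (N : ℕ) : Finset (Lat d) :=
  Finset.Icc a (fun t => a t + ((N : ℤ) - 1))

/-- The average `N^{-d} ∑_{i ∈ a + [0, N-1]^d} f(i)`. -/
def cubeAvg {d : ℕ} (f : Lat d → ℝ) (a : Lat d) (N : ℕ) : ℝ :=
  ((N : ℝ) ^ d)⁻¹ * ∑ i ∈ cube a N, f i

/-- Discrete (Muckenhoupt) `A_q`-weights, `1 ≤ q < ∞`. For `q = 1` the condition says that
the average over each cube is at most `C` times the minimum of `w` over that cube. -/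
structure IsDiscreteAq {d : ℕ} (q : ℝ) (w : Lat d → ℝ) : Prop where
  pos : ∀ i, 0 < w i
  of_one_lt : 1 < q → ∃ C : ℝ, 0 < C ∧ ∀ (a : Lat d) (N : ℕ), 1 ≤ N →
    cubeAvg w a N * cubeAvg (fun i => w i ^ (-(1 / (q - 1)))) a N ^ (q - 1) ≤ C
  of_eq_one : q = 1 → ∃ C : ℝ, 0 < C ∧ ∀ (a : Lat d) (N : ℕ), 1 ≤ N →
    ∀ i ∈ cube a N, cubeAvg w a N ≤ C * w i

/-- The norm `‖c‖_{q,w} = (∑_i |c(i)|^q w(i))^{1/q}`, with value `∞` off `ℓ^q_w`. -/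
def weightedNorm {d : ℕ} (q : ℝ) (w : Lat d → ℝ) (c : Lat d → ℂ) : ℝ≥0∞ :=
  (∑' i, ENNReal.ofReal (‖c i‖ ^ q * w i)) ^ (1 / q)

/-- `ℓ^q_w`-stability: there is `C > 0` such that for every `c ∈ ℓ^q_w` the series defining
`Ac` converge and `C⁻¹ ‖c‖_{q,w} ≤ ‖Ac‖_{q,w} ≤ C ‖c‖_{q,w}`. -/
def HasStability {d : ℕ} (A : InfMatrix d) (q : ℝ) (w : Lat d → ℝ) : Prop :=
  ∃ C : ℝ≥0, 0 < C ∧ ∀ c : Lat d → ℂ, weightedNorm q w c < ∞ →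
    (∀ i, Summable fun j => A i j * c j) ∧
    ((C⁻¹ : ℝ≥0) : ℝ≥0∞) * weightedNorm q w c ≤ weightedNorm q w (mulSeq A c) ∧
    weightedNorm q w (mulSeq A c) ≤ (C : ℝ≥0∞) * weightedNorm q w c

end BeurlingStability

end

noncomputable section

namespace BeurlingStability

/-! Membership in the class is used only to see that $|A|$ is dominated by a summable radially
decreasing kernel, its `radialProfile` (`radialSum_radialProfile_lt_top`). The core is to pass from
a lower bound in one weighted space to the pointwise bound of part 2, in which the weight no longer
appears (`HasStability.exists_radial_majorant`). Part 1 then follows because convolution with such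
kernels is bounded on $\ell^{q'}_{w'}$ for every $A_{q'}$-weight (`energy_radialConv_le`).

For the core, cut $\mathbb Z^d$ into cubes of side $N$ and take a cutoff $\varphi_m$ with Lipschitz
constant $1/N$ that is one on the $m$-th cube. Stability applied to $\varphi_m c$, together with
$A(\varphi_m c)=\varphi_m Ac+[A,\varphi_m]c$, bounds $c$ on that cube by $Ac$ near it and by a
commutator. The commutator has kernel at most $\min(|i-j|/N,1)$ times the profile, and its total
mass tends to zero as $N\to\infty$ (`exists_radialSum_dampedProfile_le`). Measure sequences by their
weighted $q$-means $b_m$ over the cubes. The $A_q$ condition makes the weights of nearby cubes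
comparable and controls plain sums over a cube by $b_m$, so the estimate becomes $b(c)\le
D*b(Ac)+V*b(c)$, where $D,V$ are radially decreasing, the constants do not depend on $N$, and $V$ is
small for large $N$ (`energy_le_of_le_commutator`).

Radially decreasing summable kernels are closed under convolution up to a constant, so $1-V$ is
inverted by a Neumann series of such kernels (`exists_le_radialConv_of_le_add`); boundedness of $c$
removes the remainder. On a single cube of fixed side, $b_m$ bounds the values of a sequence up to a
constant and is bounded by their sum, which eliminates the weight. -/

variable {d : ℕ}

/-! ### Radial sequences on the lattice -/

/-- The sup norm on `ℤ^d`, as a natural number. -/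
def latNorm (k : Lat d) : ℕ := Finset.univ.sup fun t => (k t).natAbs

theorem latNorm_le_iff {k : Lat d} {n : ℕ} : latNorm k ≤ n ↔ ∀ t, (k t).natAbs ≤ n := by
  simp [latNorm, Finset.sup_le_iff]

theorem natAbs_le_latNorm (k : Lat d) (t : Fin d) : (k t).natAbs ≤ latNorm k :=
  latNorm_le_iff.1 le_rfl t

theorem latNorm_add_le (k l : Lat d) : latNorm (k + l) ≤ latNorm k + latNorm l :=
  latNorm_le_iff.2 fun t => (Int.natAbs_add_le _ _).trans
    (add_le_add (natAbs_le_latNorm k t) (natAbs_le_latNorm l t))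

theorem latNorm_sub_comm (k l : Lat d) : latNorm (k - l) = latNorm (l - k) := by
  unfold latNorm
  congr 1
  ext t
  simp only [Pi.sub_apply]
  omega

theorem latNorm_sub_le (i j k : Lat d) : latNorm (i - k) ≤ latNorm (i - j) + latNorm (j - k) := by
  simpa using latNorm_add_le (i - j) (j - k)

theorem norm_eq_latNorm (k : Lat d) : ‖k‖ = latNorm k := by
  apply le_antisymm
  · refine (pi_norm_le_iff_of_nonneg (by positivity)).2 fun t => ?_
    rw [Int.norm_eq_abs, ← Int.cast_abs, Int.abs_eq_natAbs]
    exact_mod_cast natAbs_le_latNorm k t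
  · have : latNorm k ≤ ⌊‖k‖⌋₊ := latNorm_le_iff.2 fun t => Nat.le_floor (by
      have := norm_le_pi_norm k t
      rwa [Int.norm_eq_abs, ← Int.cast_abs, Int.abs_eq_natAbs, Int.cast_natCast] at this)
    exact (Nat.le_floor_iff (norm_nonneg k)).1 this

/-- The total mass of the radial sequence `k ↦ F |k|`. -/
def radialSum (d : ℕ) (F : ℕ → ℝ≥0∞) : ℝ≥0∞ := ∑' k : Lat d, F (latNorm k)

/-- Convolution with the radial sequence `k ↦ F |k|`. -/
def radialConv (F : ℕ → ℝ≥0∞) (x : Lat d → ℝ≥0∞) : Lat d → ℝ≥0∞ :=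
  fun i => ∑' j, F (latNorm (i - j)) * x j

theorem tsum_latNorm_sub_left (F : ℕ → ℝ≥0∞) (i : Lat d) :
    ∑' j, F (latNorm (i - j)) = radialSum d F :=
  (Equiv.subLeft i).tsum_eq fun k => F (latNorm k)

theorem tsum_latNorm_sub_right (F : ℕ → ℝ≥0∞) (j : Lat d) :
    ∑' i, F (latNorm (i - j)) = radialSum d F :=
  (Equiv.subRight j).tsum_eq fun k => F (latNorm k)

theorem radialSum_mono {F G : ℕ → ℝ≥0∞} (h : ∀ n, F n ≤ G n) : radialSum d F ≤ radialSum d G :=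
  ENNReal.tsum_le_tsum fun _ => h _

theorem radialSum_add (F G : ℕ → ℝ≥0∞) :
    radialSum d (fun n => F n + G n) = radialSum d F + radialSum d G :=
  ENNReal.tsum_add

theorem radialSum_const_mul (a : ℝ≥0∞) (F : ℕ → ℝ≥0∞) :
    radialSum d (fun n => a * F n) = a * radialSum d F :=
  ENNReal.tsum_mul_left

theorem radialConv_mono {F G : ℕ → ℝ≥0∞} {x y : Lat d → ℝ≥0∞} (h : ∀ n, F n ≤ G n)
    (hxy : ∀ j, x j ≤ y j) (i : Lat d) : radialConv F x i ≤ radialConv G y i :=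
  ENNReal.tsum_le_tsum fun _ => mul_le_mul' (h _) (hxy _)

theorem radialConv_add (F : ℕ → ℝ≥0∞) (x y : Lat d → ℝ≥0∞) (i : Lat d) :
    radialConv F (fun j => x j + y j) i = radialConv F x i + radialConv F y i := by
  simp only [radialConv, mul_add, ENNReal.tsum_add]

theorem radialConv_const (F : ℕ → ℝ≥0∞) (a : ℝ≥0∞) (i : Lat d) :
    radialConv F (fun _ => a) i = radialSum d F * a := by
  simp only [radialConv, ENNReal.tsum_mul_right, tsum_latNorm_sub_left]

theorem le_radialSum (F : ℕ → ℝ≥0∞) (k : Lat d) : F (latNorm k) ≤ radialSum d F :=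
  ENNReal.le_tsum k

theorem latNorm_zero : latNorm (0 : Lat d) = 0 := by
  simp [latNorm]

theorem le_radialSum_of_antitone {F : ℕ → ℝ≥0∞} (hF : Antitone F) (n : ℕ) :
    F n ≤ radialSum d F := by
  refine (hF (Nat.zero_le n)).trans ?_
  simpa [latNorm_zero] using le_radialSum F (0 : Lat d)

theorem tsum_comp_le_of_fiber {ι κ ρ : Type*} [Fintype ρ] (π : ι → κ) (r : ι → ρ)
    (h : Function.Injective fun i => (π i, r i)) (f : κ → ℝ≥0∞) :
    ∑' i, f (π i) ≤ Fintype.card ρ * ∑' k, f k := by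
  calc ∑' i, f (π i) ≤ ∑' z : κ × ρ, f z.1 :=
        ENNReal.tsum_comp_le_tsum_of_injective h fun z : κ × ρ => f z.1
    _ = Fintype.card ρ * ∑' k, f k := by
        rw [ENNReal.tsum_prod (f := fun k (_ : ρ) => f k), ← ENNReal.tsum_mul_left]
        simp [tsum_fintype]

/-- Dilating an antitone radial sequence by `M` multiplies its mass by at most `(2M)^d`. -/
theorem radialSum_comp_div_le (F : ℕ → ℝ≥0∞) {M : ℕ} (hM : 1 ≤ M) :
    radialSum d (fun n => F (n / M)) ≤ (2 * M) ^ d * radialSum d F := by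
  -- Division truncated towards zero commutes with absolute values, hence with the sup norm. Two
  -- integers with the same truncated quotient by $M$ differ by less than $2M$, so residues mod $2M$
  -- separate the fibres.
  have : NeZero (2 * M) := ⟨by omega⟩
  have habs : ∀ a : ℤ, (a.tdiv M).natAbs = a.natAbs / M := fun a => by
    rw [Int.natAbs_tdiv]
    rfl
  have hnorm : ∀ k : Lat d, latNorm k / M = latNorm fun t => (k t).tdiv M := by
    intro k
    apply le_antisymm
    · have hk : latNorm k ≤ M * (latNorm fun t => (k t).tdiv M) + (M - 1) := by
        refine latNorm_le_iff.2 fun t => ?_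
        have h1 := natAbs_le_latNorm (fun t => (k t).tdiv M) t
        simp only [habs] at h1
        have h2 := Nat.div_add_mod (k t).natAbs M
        have h3 := Nat.mod_lt (k t).natAbs (show 0 < M by omega)
        have h4 := Nat.mul_le_mul_left M h1
        omega
      refine Nat.le_of_lt_succ ((Nat.div_lt_iff_lt_mul (by omega)).2 ?_)
      rw [Nat.succ_mul, mul_comm]
      omega
    · refine latNorm_le_iff.2 fun t => ?_
      simp only [habs]
      exact Nat.div_le_div_right (natAbs_le_latNorm k t)
  have hinj : Function.Injective fun k : Lat d =>
      ((fun t => (k t).tdiv M : Lat d), (fun t => (k t : ZMod (2 * M)) : Fin d → ZMod (2 * M))) := by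
    intro k l hkl
    simp only [Prod.mk.injEq, funext_iff] at hkl
    funext t
    have h1 := hkl.1 t
    have h2 := (ZMod.intCast_eq_intCast_iff_dvd_sub _ _ _).1 (hkl.2 t)
    have h3 := Int.mul_tdiv_add_tmod (k t) M
    have h4 := Int.mul_tdiv_add_tmod (l t) M
    have h5 := Int.natAbs_tmod (k t) M
    have h6 := Int.natAbs_tmod (l t) M
    have h7 := Nat.mod_lt (k t).natAbs (show 0 < M by omega)
    have h8 := Nat.mod_lt (l t).natAbs (show 0 < M by omega)
    rw [h1] at h3
    simp only [Int.natAbs_natCast] at h5 h6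
    have h9 := Int.eq_zero_of_abs_lt_dvd h2 (by push_cast; rw [abs_lt]; omega)
    omega
  calc radialSum d (fun n => F (n / M)) = ∑' k : Lat d, F (latNorm fun t => (k t).tdiv M) := by
        simp only [radialSum, hnorm]
    _ ≤ _ := by
        refine (tsum_comp_le_of_fiber (fun k : Lat d => fun t => (k t).tdiv M) _ hinj
          fun k => F (latNorm k)).trans (le_of_eq ?_)
        simp [radialSum, ZMod.card]

/-- Turns a shift of the radius into a dilation, whose effect on the mass is known. -/
theorem comp_sub_le_comp_div {F : ℕ → ℝ≥0∞} (hF : Antitone F) (n r : ℕ) :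
    F (n - r) ≤ F (n / (r + 1)) := by
  apply hF
  rcases Nat.eq_zero_or_pos (n / (r + 1)) with h | h
  · omega
  · have h1 := Nat.div_add_mod n (r + 1)
    have h2 : r * 1 ≤ r * (n / (r + 1)) := Nat.mul_le_mul_left r h
    rw [add_mul, one_mul] at h1
    omega

/-! ### Radially decreasing kernels: products and Neumann series -/

/-- A radial majorant of the convolution of two radial sequences. -/
def radialMul (d : ℕ) (F G : ℕ → ℝ≥0∞) : ℕ → ℝ≥0∞ :=
  fun n => radialSum d G * F (n / 2) + radialSum d F * G (n / 2)

theorem antitone_radialMul {F G : ℕ → ℝ≥0∞} (hF : Antitone F) (hG : Antitone G) :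
    Antitone (radialMul d F G) := fun _ _ h =>
  add_le_add (mul_le_mul_right (hF (Nat.div_le_div_right h)) _)
    (mul_le_mul_right (hG (Nat.div_le_div_right h)) _)

theorem radialSum_radialMul_le (F G : ℕ → ℝ≥0∞) :
    radialSum d (radialMul d F G) ≤ 2 * 4 ^ d * (radialSum d F * radialSum d G) := by
  unfold radialMul
  rw [radialSum_add, radialSum_const_mul, radialSum_const_mul]
  have h := fun H : ℕ → ℝ≥0∞ => radialSum_comp_div_le (d := d) H (M := 2) (by norm_num)
  norm_num at h
  calc _ ≤ radialSum d G * (4 ^ d * radialSum d F) + radialSum d F * (4 ^ d * radialSum d G) := by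
        gcongr <;> exact h _
    _ = _ := by ring

/-- By the triangle inequality one of $|i-j|$, $|j-k|$ is at least half of $|i-k|$; evaluate that
kernel at the half distance and sum the other over $j$. -/
theorem radialConv_radialConv_le {F G : ℕ → ℝ≥0∞} (hF : Antitone F) (hG : Antitone G)
    (x : Lat d → ℝ≥0∞) (i : Lat d) :
    radialConv F (radialConv G x) i ≤ radialConv (radialMul d F G) x i := by
  unfold radialConv
  simp only [← ENNReal.tsum_mul_left]
  rw [ENNReal.tsum_comm]
  refine ENNReal.tsum_le_tsum fun k => ?_
  simp only [← mul_assoc, ENNReal.tsum_mul_right]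
  gcongr
  unfold radialMul
  rw [← tsum_latNorm_sub_right G k, ← tsum_latNorm_sub_left F i, ← ENNReal.tsum_mul_right,
    ← ENNReal.tsum_mul_right, ← ENNReal.tsum_add]
  refine ENNReal.tsum_le_tsum fun j => ?_
  have h := latNorm_sub_le i j k
  rcases le_total (latNorm (i - k) / 2) (latNorm (i - j)) with h1 | h1
  · rw [mul_comm]
    exact le_add_right (mul_le_mul_right (hF h1) _)
  · have h2 : latNorm (i - k) / 2 ≤ latNorm (j - k) := by omega
    exact le_add_left (mul_le_mul_right (hG h2) _)

/-- The majorants of the terms of the Neumann series `∑ V^n D`. -/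
def neumannTerm (d : ℕ) (V D : ℕ → ℝ≥0∞) : ℕ → ℕ → ℝ≥0∞
  | 0 => D
  | n + 1 => radialMul d V (neumannTerm d V D n)

theorem antitone_neumannTerm {V D : ℕ → ℝ≥0∞} (hV : Antitone V) (hD : Antitone D) (n : ℕ) :
    Antitone (neumannTerm d V D n) := by
  induction n with
  | zero => exact hD
  | succ n ih => exact antitone_radialMul hV ih

theorem radialSum_neumannTerm_le (V D : ℕ → ℝ≥0∞) (n : ℕ) :
    radialSum d (neumannTerm d V D n) ≤ (2 * 4 ^ d * radialSum d V) ^ n * radialSum d D := by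
  induction n with
  | zero => simp [neumannTerm]
  | succ n ih =>
    refine (radialSum_radialMul_le _ _).trans ?_
    calc _ ≤ 2 * 4 ^ d * (radialSum d V *
          ((2 * 4 ^ d * radialSum d V) ^ n * radialSum d D)) := by gcongr
      _ = _ := by ring

/-- Inversion of `1 - V` in the Beurling algebra of radially decreasing kernels. -/
theorem exists_le_radialConv_of_le_add {V D : ℕ → ℝ≥0∞} (hV : Antitone V) (hD : Antitone D)
    (hVs : 2 * 4 ^ d * radialSum d V ≤ 2⁻¹) (hDs : radialSum d D < ∞) :
    ∃ P : ℕ → ℝ≥0∞, Antitone P ∧ radialSum d P < ∞ ∧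
      ∀ (a b : Lat d → ℝ≥0∞) (M : ℝ≥0∞), M < ∞ → (∀ i, a i ≤ M) →
        (∀ i, a i ≤ radialConv D b i + radialConv V a i) → ∀ i, a i ≤ radialConv P b i := by
  refine ⟨fun n => ∑' k, neumannTerm d V D k n, ?_, ?_, ?_⟩
  · intro m n h
    exact ENNReal.tsum_le_tsum fun k => antitone_neumannTerm hV hD k h
  · unfold radialSum
    rw [ENNReal.tsum_comm]
    calc ∑' k, radialSum d (neumannTerm d V D k) ≤ ∑' k : ℕ, (2⁻¹ : ℝ≥0∞) ^ k * radialSum d D :=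
          ENNReal.tsum_le_tsum fun k => (radialSum_neumannTerm_le V D k).trans (by gcongr)
      _ = 2 * radialSum d D := by
          rw [ENNReal.tsum_mul_right, ENNReal.tsum_geometric]
          simp
      _ < ∞ := ENNReal.mul_lt_top (by norm_num) hDs
  · intro a b M hM haM hab i
    have hVs' : radialSum d V ≤ 2⁻¹ := by
      refine le_trans ?_ hVs
      refine le_mul_of_one_le_left' ?_
      exact one_le_mul one_le_two (one_le_pow₀ (by norm_num))
    -- Substituting the hypothesis into itself $n$ times leaves a remainder of at most $2^{-n}M$,
    -- since $V$ has mass at most $1/2$. It vanishes in the limit because $M$ is finite.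
    have key : ∀ n : ℕ, ∀ i, a i ≤
        (∑ k ∈ Finset.range n, radialConv (neumannTerm d V D k) b i) + 2⁻¹ ^ n * M := by
      intro n
      induction n with
      | zero => intro i; simpa using haM i
      | succ n ih =>
        intro i
        have hsum : ∀ (s : Finset ℕ) (f : ℕ → Lat d → ℝ≥0∞),
            radialConv V (fun j => ∑ k ∈ s, f k j) i = ∑ k ∈ s, radialConv V (f k) i := by
          intro s f
          simp only [radialConv, Finset.mul_sum]
          exact Summable.tsum_finsetSum fun _ _ => ENNReal.summable
        calc a i ≤ radialConv D b i + radialConv V a i := hab i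
          _ ≤ radialConv D b i + radialConv V (fun j => (∑ k ∈ Finset.range n,
                radialConv (neumannTerm d V D k) b j) + 2⁻¹ ^ n * M) i := by
              gcongr
              exact radialConv_mono (fun _ => le_rfl) ih i
          _ ≤ radialConv D b i + (∑ k ∈ Finset.range n,
                radialConv (neumannTerm d V D (k + 1)) b i + 2⁻¹ * (2⁻¹ ^ n * M)) := by
              rw [radialConv_add, hsum, radialConv_const]
              gcongr with k _
              exact radialConv_radialConv_le hV (antitone_neumannTerm hV hD k) b i
          _ = _ := by
              rw [Finset.sum_range_succ', pow_succ']
              simp only [neumannTerm]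
              ring
    have hle : ∀ n : ℕ, a i ≤ radialConv (fun n => ∑' k, neumannTerm d V D k n) b i
        + 2⁻¹ ^ n * M := by
      intro n
      refine (key n i).trans ?_
      gcongr
      refine (ENNReal.sum_le_tsum _).trans ?_
      unfold radialConv
      rw [ENNReal.tsum_comm]
      simp only [ENNReal.tsum_mul_right, le_refl]
    have hlim : Filter.Tendsto (fun n : ℕ => radialConv (fun n => ∑' k, neumannTerm d V D k n) b i
        + 2⁻¹ ^ n * M) Filter.atTop
        (nhds (radialConv (fun n => ∑' k, neumannTerm d V D k n) b i + 0 * M)) := by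
      refine Filter.Tendsto.const_add _ (ENNReal.Tendsto.mul_const ?_ (Or.inr hM.ne))
      exact ENNReal.tendsto_pow_atTop_nhds_zero_of_lt_one (by simp [ENNReal.inv_lt_one])
    simpa using ge_of_tendsto' hlim hle

/-! ### Summability of the radial profile of a matrix -/

/-- The least antitone radial majorant of `|A|`. -/
def radialProfile (A : InfMatrix d) : ℕ → ℝ≥0∞ :=
  fun n => ⨆ (i : Lat d) (j : Lat d) (_ : n ≤ latNorm (i - j)), ‖A i j‖ₑ

theorem antitone_radialProfile (A : InfMatrix d) : Antitone (radialProfile A) := fun _ _ h =>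
  iSup₂_mono fun _ _ => iSup_mono' fun hn => ⟨h.trans hn, le_rfl⟩

theorem enorm_le_radialProfile (A : InfMatrix d) (i j : Lat d) :
    ‖A i j‖ₑ ≤ radialProfile A (latNorm (i - j)) :=
  le_iSup_of_le i <| le_iSup_of_le j <| le_iSup_of_le le_rfl le_rfl

theorem tsum_mul_le_rpow_mul_rpow {ι : Type*} {p q : ℝ} (hpq : p.HolderConjugate q)
    (f g : ι → ℝ≥0∞) :
    ∑' i, f i * g i ≤ (∑' i, f i ^ p) ^ (1 / p) * (∑' i, g i ^ q) ^ (1 / q) := by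
  rw [ENNReal.tsum_eq_iSup_sum]
  refine iSup_le fun s => (ENNReal.inner_le_Lp_mul_Lq s f g hpq).trans ?_
  have h1 : 0 ≤ 1 / p := by have := hpq.pos; positivity
  have h2 : 0 ≤ 1 / q := by have := hpq.symm.pos; positivity
  gcongr <;> exact ENNReal.sum_le_tsum _

theorem tsum_mul_le_lpNorm_mul {p : ℝ≥0∞} (hp : 1 ≤ p) (f g : Lat d → ℝ≥0∞) :
    ∑' k, f k * g k ≤ lpNorm p f * lpNorm p.conjExponent g := by
  have hconj : p.HolderConjugate p.conjExponent := .conjExponent hp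
  rcases eq_or_ne p ∞ with rfl | hp1
  · have h1 : (∞ : ℝ≥0∞).conjExponent = 1 := by simp [ENNReal.conjExponent]
    simp only [h1, lpNorm, ENNReal.one_ne_top, if_true, if_false, ENNReal.toReal_one,
      ENNReal.rpow_one, div_one]
    rw [← ENNReal.tsum_mul_left]
    exact ENNReal.tsum_le_tsum fun k => mul_le_mul_left (le_iSup f k) _
  rcases eq_or_ne p 1 with rfl | hp2
  · have h1 : (1 : ℝ≥0∞).conjExponent = ∞ := by simp [ENNReal.conjExponent]
    simp only [h1, lpNorm, ENNReal.one_ne_top, if_true, if_false, ENNReal.toReal_one,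
      ENNReal.rpow_one, div_one]
    rw [← ENNReal.tsum_mul_right]
    exact ENNReal.tsum_le_tsum fun k => mul_le_mul_right (le_iSup g k) _
  · have hlt : 1 < p := lt_of_le_of_ne hp hp2.symm
    have hq : p.conjExponent ≠ ∞ := by
      simp only [ENNReal.conjExponent, ne_eq, ENNReal.add_eq_top, ENNReal.one_ne_top,
        ENNReal.inv_eq_top, false_or]
      exact (tsub_pos_of_lt hlt).ne'
    have := hconj
    have h := tsum_mul_le_rpow_mul_rpow
      (p := p.toReal) (q := p.conjExponent.toReal) (ENNReal.HolderConjugate.toReal_of_ne_top hp1 hq) f g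
    simpa [lpNorm, hp1, hq] using h

theorem le_radialSup {f : Lat d → Lat d → ℝ≥0∞} {i j k : Lat d} (h : ‖k‖ ≤ ‖i - j‖) :
    f i j ≤ radialSup f k :=
  le_iSup_of_le (f := fun i => ⨆ (j : Lat d) (_ : ‖k‖ ≤ ‖i - j‖), f i j) i <|
    le_iSup_of_le (f := fun j => ⨆ (_ : ‖k‖ ≤ ‖i - j‖), f i j) j <| le_iSup_of_le h le_rfl

/-- Since $v\ge1$, $|a|\le(|a|u)(v/u)$; Hölder applies to the radial suprema of the two factors. -/
theorem radialSum_radialProfile_lt_top {p : ℝ≥0∞} (hp : 1 ≤ p) {u : Lat d → Lat d → ℝ}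
    (hu : IsSubmultiplicative p u) {A : InfMatrix d} (hA : A ∈ beurlingClass p u) :
    radialSum d (radialProfile A) < ∞ := by
  obtain ⟨hu1, v, hv⟩ := hu
  refine lt_of_le_of_lt ?_ (ENNReal.mul_lt_top hA hv.norm_lt_top)
  refine le_trans ?_ (tsum_mul_le_lpNorm_mul hp _ _)
  refine ENNReal.tsum_le_tsum fun k => iSup_le fun i => iSup_le fun j => iSup_le fun hk => ?_
  have hk' : ‖k‖ ≤ ‖i - j‖ := by
    rw [norm_eq_latNorm, norm_eq_latNorm]
    exact_mod_cast hk
  calc ‖A i j‖ₑ ≤ ENNReal.ofReal (‖A i j‖ * u i j) * ENNReal.ofReal (v i j * (u i j)⁻¹) := by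
        have h1 := hu1 i j
        have h2 := hv.weight i j
        rw [← ENNReal.ofReal_mul (by positivity), ← ofReal_norm]
        apply ENNReal.ofReal_le_ofReal
        rw [mul_assoc, mul_left_comm (u i j), mul_inv_cancel₀ (by positivity), mul_one]
        exact le_mul_of_one_le_right (norm_nonneg _) h2
    _ ≤ _ := mul_le_mul' (le_radialSup hk') (le_radialSup hk')

/-! ### Muckenhoupt weights through averages over cubes -/

/-- The dual form of the `A_q` condition. -/
structure IsCubeWeight (q : ℝ) (W : Lat d → ℝ≥0∞) (C : ℝ≥0∞) : Prop where
  one_le : 1 ≤ q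
  ne_zero : ∀ i, W i ≠ 0
  ne_top : ∀ i, W i ≠ ∞
  const_ne_top : C ≠ ∞
  le : ∀ (a : Lat d) (N : ℕ), 1 ≤ N → ∀ x : Lat d → ℝ≥0∞,
    (∑ i ∈ cube a N, x i) ^ q * ∑ i ∈ cube a N, W i ≤
      C * ((N : ℝ≥0∞) ^ d) ^ q * ∑ i ∈ cube a N, x i ^ q * W i

/-- Hölder for $x=(xW^{1/q})\,W^{-1/q}$; this brings in the dual weight of the $A_q$ condition. -/
theorem sum_rpow_le_mul_sum_rpow {ι : Type*} (s : Finset ι) {q : ℝ} (hq : 1 < q)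
    (x W : ι → ℝ≥0∞) (h0 : ∀ i, W i ≠ 0) (ht : ∀ i, W i ≠ ∞) :
    (∑ i ∈ s, x i) ^ q ≤
      (∑ i ∈ s, x i ^ q * W i) * (∑ i ∈ s, W i ^ (-(1 / (q - 1)))) ^ (q - 1) := by
  have hq0 : 0 < q := by linarith
  have hq1 : 0 < q - 1 := by linarith
  have h := ENNReal.inner_le_Lp_mul_Lq s (fun i => x i * W i ^ (1 / q)) (fun i => W i ^ (-(1 / q)))
    (Real.HolderConjugate.conjExponent hq)
  have h1 : ∀ i, x i * W i ^ (1 / q) * W i ^ (-(1 / q)) = x i := fun i => by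
    rw [mul_assoc, ← ENNReal.rpow_add _ _ (h0 i) (ht i)]
    simp
  have h2 : ∀ i, (x i * W i ^ (1 / q)) ^ q = x i ^ q * W i := fun i => by
    rw [ENNReal.mul_rpow_of_nonneg _ _ hq0.le, ← ENNReal.rpow_mul, one_div_mul_cancel hq0.ne',
      ENNReal.rpow_one]
  have h3 : ∀ i, (W i ^ (-(1 / q))) ^ (q.conjExponent) = W i ^ (-(1 / (q - 1))) := fun i => by
    rw [← ENNReal.rpow_mul]
    congr 1
    unfold Real.conjExponent
    field_simp
  simp only [h1, h2, h3] at h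
  refine (ENNReal.rpow_le_rpow h hq0.le).trans (le_of_eq ?_)
  rw [ENNReal.mul_rpow_of_nonneg _ _ hq0.le, ← ENNReal.rpow_mul, ← ENNReal.rpow_mul,
    one_div_mul_cancel hq0.ne', ENNReal.rpow_one]
  congr 2
  unfold Real.conjExponent
  field_simp

theorem IsDiscreteAq.exists_isCubeWeight {q : ℝ} (hq : 1 ≤ q) {w : Lat d → ℝ}
    (hw : IsDiscreteAq q w) : ∃ C, IsCubeWeight q (fun i => ENNReal.ofReal (w i)) C := by
  have hpos := hw.pos
  rcases hq.eq_or_lt with rfl | hq1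
  · obtain ⟨C, hC, h⟩ := hw.of_eq_one rfl
    refine ⟨ENNReal.ofReal C, le_rfl, fun i => by simpa using hpos i, fun i => by simp, by simp, ?_⟩
    intro a N hN x
    simp only [ENNReal.rpow_one]
    rw [Finset.sum_mul, Finset.mul_sum]
    refine Finset.sum_le_sum fun i hi => ?_
    have h1 := h a N hN i hi
    unfold cubeAvg at h1
    have hN' : (0 : ℝ) < (N : ℝ) ^ d := by positivity
    rw [inv_mul_le_iff₀ hN'] at h1
    rw [mul_left_comm]
    gcongr
    rw [← ENNReal.ofReal_sum_of_nonneg fun i _ => (hpos i).le, ← ENNReal.ofReal_natCast,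
      ← ENNReal.ofReal_pow (by positivity), ← ENNReal.ofReal_mul hC.le,
      ← ENNReal.ofReal_mul (by positivity)]
    apply ENNReal.ofReal_le_ofReal
    linarith
  · obtain ⟨C, hC, h⟩ := hw.of_one_lt hq1
    have hq2 : 0 < q - 1 := by linarith
    refine ⟨ENNReal.ofReal C, hq, fun i => by simpa using hpos i, fun i => by simp, by simp, ?_⟩
    intro a N hN x
    refine (mul_le_mul_left (sum_rpow_le_mul_sum_rpow _ hq1 x
      (fun i => ENNReal.ofReal (w i))
      (fun i => by simpa using hpos i) fun i => by simp) _).trans ?_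
    rw [mul_assoc, mul_comm]
    refine mul_le_mul_left ?_ _
    have h1 := h a N hN
    unfold cubeAvg at h1
    have hN' : (0 : ℝ) < (N : ℝ) ^ d := by positivity
    have hT : 0 ≤ ∑ i ∈ cube a N, w i ^ (-(1 / (q - 1))) :=
      Finset.sum_nonneg fun i _ => (Real.rpow_pos_of_pos (hpos i) _).le
    have h2 : (∑ i ∈ cube a N, w i ^ (-(1 / (q - 1)))) ^ (q - 1) * ∑ i ∈ cube a N, w i ≤
        C * ((N : ℝ) ^ d) ^ q := by
      rw [Real.mul_rpow (by positivity) hT, Real.inv_rpow hN'.le] at h1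
      have h3 : ((N : ℝ) ^ d) ^ q = (N : ℝ) ^ d * ((N : ℝ) ^ d) ^ (q - 1) := by
        rw [Real.rpow_sub_one hN'.ne']
        field_simp
      rw [h3, ← div_le_iff₀ (by positivity)]
      refine le_trans (le_of_eq ?_) h1
      field_simp
    have h4 : ∀ i, ENNReal.ofReal (w i) ^ (-(1 / (q - 1))) =
        ENNReal.ofReal (w i ^ (-(1 / (q - 1)))) := fun i =>
      ENNReal.ofReal_rpow_of_pos (hpos i)
    simp only [h4]
    rw [← ENNReal.ofReal_sum_of_nonneg fun i _ => (hpos i).le,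
      ← ENNReal.ofReal_sum_of_nonneg fun i _ => (Real.rpow_pos_of_pos (hpos i) _).le,
      ENNReal.ofReal_rpow_of_nonneg hT hq2.le, ← ENNReal.ofReal_natCast,
      ← ENNReal.ofReal_pow (by positivity), ENNReal.ofReal_rpow_of_nonneg (by positivity)
      (by linarith), ← ENNReal.ofReal_mul hC.le, ← ENNReal.ofReal_mul (by positivity)]
    exact ENNReal.ofReal_le_ofReal h2

/-! ### Radial convolution on weighted spaces -/

theorem mem_cube {a i : Lat d} {N : ℕ} :
    i ∈ cube a N ↔ ∀ t, a t ≤ i t ∧ i t ≤ a t + ((N : ℤ) - 1) := by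
  simp only [cube, Finset.mem_Icc, Pi.le_def, forall_and]

theorem card_cube (a : Lat d) (N : ℕ) : (cube a N).card = N ^ d := by
  have h : ∀ t, (a t + ((N : ℤ) - 1) + 1 - a t).toNat = N := fun t => by omega
  simp [cube, Pi.card_Icc, h]

/-- The ball of radius `m` in the sup norm. -/
def latBall (l : Lat d) (m : ℕ) : Finset (Lat d) := cube (fun t => l t - m) (2 * m + 1)

theorem mem_latBall {i l : Lat d} {m : ℕ} : i ∈ latBall l m ↔ latNorm (i - l) ≤ m := by
  rw [latBall, mem_cube, latNorm_le_iff]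
  refine forall_congr' fun t => ?_
  simp only [Pi.sub_apply]
  push_cast
  omega

theorem mem_latBall_comm {i l : Lat d} {m : ℕ} : i ∈ latBall l m ↔ l ∈ latBall i m := by
  rw [mem_latBall, mem_latBall, latNorm_sub_comm]

theorem card_latBall (l : Lat d) (m : ℕ) : (latBall l m).card = (2 * m + 1) ^ d :=
  card_cube _ _

theorem sum_eq_tsum_ite {ι : Type*} [DecidableEq ι] (s : Finset ι) (f : ι → ℝ≥0∞) :
    ∑ i ∈ s, f i = ∑' i, if i ∈ s then f i else 0 := by
  rw [tsum_eq_sum (s := s) (fun i hi => by simp [hi])]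
  exact Finset.sum_congr rfl fun i hi => by simp [hi]

theorem tsum_sum_latBall_comm (m : ℕ) (f : Lat d → Lat d → ℝ≥0∞) :
    ∑' i, ∑ l ∈ latBall i m, f i l = ∑' l, ∑ i ∈ latBall l m, f i l := by
  simp only [sum_eq_tsum_ite]
  rw [ENNReal.tsum_comm]
  simp only [mem_latBall_comm]

theorem tsum_sum_latBall (m : ℕ) (f : Lat d → ℝ≥0∞) :
    ∑' l, ∑ i ∈ latBall l m, f i = ((2 * m + 1 : ℕ) : ℝ≥0∞) ^ d * ∑' i, f i := by
  rw [← tsum_sum_latBall_comm m fun i _ => f i, ← ENNReal.tsum_mul_left]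
  simp [card_latBall]

/-- The `q`-th power of the weighted `ℓ^q`-norm. -/
def energy (q : ℝ) (W x : Lat d → ℝ≥0∞) : ℝ≥0∞ := ∑' i, x i ^ q * W i

theorem energy_mono {q : ℝ} (hq : 0 ≤ q) {W x y : Lat d → ℝ≥0∞} (h : ∀ i, x i ≤ y i) :
    energy q W x ≤ energy q W y :=
  ENNReal.tsum_le_tsum fun i => mul_le_mul_left (ENNReal.rpow_le_rpow (h i) hq) _

/-- The ball around $i$ moves with $i$, while the cube condition concerns a fixed cube. Averaging
over an auxiliary centre $l$ within $m$ of $i$ replaces it by the ball of radius $2m$ around $l$,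
which contains both $i$ and the original ball. The doubled radius costs the powers of $2^d$. -/
theorem energy_sum_latBall_le {q : ℝ} {W : Lat d → ℝ≥0∞} {C : ℝ≥0∞} (hW : IsCubeWeight q W C)
    (x : Lat d → ℝ≥0∞) (m : ℕ) :
    energy q W (fun i => ∑ j ∈ latBall i m, x j) ≤
      C * (2 ^ d) ^ q * 2 ^ d * (((2 * m + 1 : ℕ) : ℝ≥0∞) ^ d) ^ q * energy q W x := by
  have hq : 0 ≤ q := zero_le_one.trans hW.one_le
  set L : ℝ≥0∞ := ((2 * m + 1 : ℕ) : ℝ≥0∞) ^ d with hL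
  set M : ℝ≥0∞ := ((2 * (2 * m) + 1 : ℕ) : ℝ≥0∞) ^ d with hM
  have hL0 : L ≠ 0 := pow_ne_zero _ (by norm_cast)
  have hLt : L ≠ ∞ := ENNReal.pow_ne_top (ENNReal.natCast_ne_top _)
  have hML : M ≤ 2 ^ d * L := by
    rw [hM, hL, ← mul_pow]
    gcongr
    norm_cast
    omega
  have h1 : L * energy q W (fun i => ∑ j ∈ latBall i m, x j) ≤
      C * M ^ q * (M * energy q W x) := by
    calc L * energy q W (fun i => ∑ j ∈ latBall i m, x j)
        = ∑' i, ∑ _l ∈ latBall i m, (∑ j ∈ latBall i m, x j) ^ q * W i := by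
          rw [energy, ← ENNReal.tsum_mul_left]
          simp [card_latBall, hL]
      _ ≤ ∑' i, ∑ l ∈ latBall i m, (∑ j ∈ latBall l (2 * m), x j) ^ q * W i := by
          refine ENNReal.tsum_le_tsum fun i => Finset.sum_le_sum fun l hl => ?_
          gcongr
          intro j hj
          rw [mem_latBall] at *
          have := latNorm_sub_le j i l
          rw [latNorm_sub_comm i l] at this
          omega
      _ = ∑' l, ∑ i ∈ latBall l m, (∑ j ∈ latBall l (2 * m), x j) ^ q * W i :=
          tsum_sum_latBall_comm m _
      _ ≤ ∑' l, C * M ^ q * ∑ j ∈ latBall l (2 * m), x j ^ q * W j := by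
          refine ENNReal.tsum_le_tsum fun l => ?_
          refine le_trans ?_ (hW.le _ (2 * (2 * m) + 1) (by omega) x)
          rw [← Finset.mul_sum]
          refine mul_le_mul_right (Finset.sum_le_sum_of_subset fun i hi => ?_) _
          change i ∈ latBall l (2 * m)
          rw [mem_latBall] at *
          omega
      _ = C * M ^ q * (M * energy q W x) := by
          rw [ENNReal.tsum_mul_left, tsum_sum_latBall, energy]
  rw [← ENNReal.mul_le_mul_iff_right hL0 hLt]
  refine h1.trans ?_
  calc C * M ^ q * (M * energy q W x) ≤ C * (2 ^ d * L) ^ q * (2 ^ d * L * energy q W x) := by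
        gcongr
    _ = _ := by
        rw [ENNReal.mul_rpow_of_nonneg _ _ hq]
        ring

/-- The diagonal points $(t,\dots,t)$, $0\le t<n$, already contribute this much; they are distinct
because $d\ge1$. -/
theorem natCast_mul_le_radialSum (hd : 1 ≤ d) {F : ℕ → ℝ≥0∞} (hF : Antitone F) (n : ℕ) :
    n * F n ≤ radialSum d F := by
  have hinj : Function.Injective fun (t : Fin n) => (fun _ => (t : ℤ) : Lat d) := by
    intro s t h
    have := congrFun h ⟨0, hd⟩
    simp only [Nat.cast_inj] at this
    exact Fin.ext this
  refine le_trans ?_ (ENNReal.tsum_comp_le_tsum_of_injective hinj fun k : Lat d => F (latNorm k))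
  rw [tsum_fintype]
  calc (n : ℝ≥0∞) * F n = ∑ _t : Fin n, F n := by simp
    _ ≤ _ := Finset.sum_le_sum fun t _ => hF (latNorm_le_iff.2 fun _ => by
      simp only [Int.natAbs_natCast]
      exact t.2.le)

theorem tendsto_zero_of_radialSum (hd : 1 ≤ d) {F : ℕ → ℝ≥0∞} (hF : Antitone F)
    (hS : radialSum d F ≠ ∞) : Filter.Tendsto F Filter.atTop (nhds 0) := by
  have h : Filter.Tendsto (fun n : ℕ => radialSum d F * (n : ℝ≥0∞)⁻¹) Filter.atTop
      (nhds (radialSum d F * 0)) :=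
    ENNReal.Tendsto.const_mul ENNReal.tendsto_inv_nat_nhds_zero (Or.inr hS)
  rw [mul_zero] at h
  refine tendsto_of_tendsto_of_tendsto_of_le_of_le' tendsto_const_nhds h
    (Filter.Eventually.of_forall fun _ => zero_le) ?_
  filter_upwards [Filter.eventually_ge_atTop 1] with n hn
  rw [← div_eq_mul_inv, ENNReal.le_div_iff_mul_le (by left; norm_cast; omega) (by simp), mul_comm]
  exact natCast_mul_le_radialSum hd hF n

theorem tsum_ite_sub_succ {F : ℕ → ℝ≥0∞} (hF : Antitone F)
    (h0 : Filter.Tendsto F Filter.atTop (nhds 0)) (n : ℕ) :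
    ∑' m, (if n ≤ m then F m - F (m + 1) else 0) = F n := by
  have key : ∀ M, n ≤ M →
      (∑ m ∈ Finset.range M, if n ≤ m then F m - F (m + 1) else 0) + F M = F n := by
    intro M hM
    induction M, hM using Nat.le_induction with
    | base =>
      rw [Finset.sum_eq_zero, zero_add]
      intro m hm
      rw [if_neg (by simpa using hm)]
    | succ M hM ih =>
      rw [Finset.sum_range_succ, if_pos hM, add_assoc, tsub_add_cancel_of_le (hF M.le_succ), ih]
  have h1 := (ENNReal.tendsto_nat_tsum
    fun m => if n ≤ m then F m - F (m + 1) else 0).add h0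
  rw [add_zero] at h1
  refine tendsto_nhds_unique h1 (tendsto_const_nhds.congr' ?_)
  filter_upwards [Filter.eventually_ge_atTop n] with M hM
  exact (key M hM).symm

theorem rpow_tsum_mul_le {ι : Type*} {q : ℝ} (hq : 1 ≤ q) (p z : ι → ℝ≥0∞) :
    (∑' i, p i * z i) ^ q ≤ (∑' i, p i) ^ (q - 1) * ∑' i, p i * z i ^ q := by
  have hq0 : 0 < q := by linarith
  have hq1 : 0 ≤ 1 - q⁻¹ := by
    have := inv_le_one_of_one_le₀ hq
    linarith
  have h : ∑' i, p i * z i ≤ (∑' i, p i) ^ (1 - q⁻¹) * (∑' i, p i * z i ^ q) ^ q⁻¹ := by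
    rw [ENNReal.tsum_eq_iSup_sum]
    refine iSup_le fun s => (ENNReal.inner_le_weight_mul_Lp_of_nonneg s hq p z).trans ?_
    gcongr <;> exact ENNReal.sum_le_tsum _
  refine (ENNReal.rpow_le_rpow h hq0.le).trans (le_of_eq ?_)
  rw [ENNReal.mul_rpow_of_nonneg _ _ hq0.le, ← ENNReal.rpow_mul, ← ENNReal.rpow_mul,
    inv_mul_cancel₀ hq0.ne', ENNReal.rpow_one, sub_mul, inv_mul_cancel₀ hq0.ne', one_mul]

/-- Convolution with a summable radially decreasing sequence is bounded on weighted `ℓ^q`. -/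
theorem energy_radialConv_le (hd : 1 ≤ d) {q : ℝ} {W : Lat d → ℝ≥0∞} {C : ℝ≥0∞}
    (hW : IsCubeWeight q W C) {F : ℕ → ℝ≥0∞} (hF : Antitone F) (hS : radialSum d F ≠ ∞)
    (x : Lat d → ℝ≥0∞) :
    energy q W (radialConv F x) ≤
      C * (2 ^ d) ^ q * 2 ^ d * radialSum d F ^ q * energy q W x := by
  have hq : 0 ≤ q := zero_le_one.trans hW.one_le
  have h0 := tendsto_zero_of_radialSum hd hF hS
  set D : ℕ → ℝ≥0∞ := fun m => F m - F (m + 1) with hD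
  set L : ℕ → ℝ≥0∞ := fun m => ((2 * m + 1 : ℕ) : ℝ≥0∞) ^ d with hL
  have hL0 : ∀ m, L m ≠ 0 := fun m => pow_ne_zero _ (by norm_cast)
  have hLt : ∀ m, L m ≠ ∞ := fun m => ENNReal.pow_ne_top (ENNReal.natCast_ne_top _)
  -- Layer-cake decomposition: $F$ is a positive combination of indicators of balls. Thus the
  -- convolution is a combination of ball averages with weights $D_mL_m$ of total mass `radialSum d
  -- F`. Jensen then reduces the bound to a single ball average, with a constant independent of the
  -- radius.
  have hFD : ∀ n, F n = ∑' m, if n ≤ m then D m else 0 := fun n =>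
    (tsum_ite_sub_succ hF h0 n).symm
  have hite : ∀ (m : ℕ) (i j : Lat d) (a : ℝ≥0∞), (if latNorm (i - j) ≤ m then a else 0) =
      if j ∈ latBall i m then a else 0 := fun m i j a => by
    simp only [mem_latBall, latNorm_sub_comm]
  have hconv : ∀ i, radialConv F x i = ∑' m, (D m * L m) * ((∑ j ∈ latBall i m, x j) / L m) := by
    intro i
    have h1 : ∀ m, (D m * L m) * ((∑ j ∈ latBall i m, x j) / L m) =
        ∑' j, (if latNorm (i - j) ≤ m then D m else 0) * x j := by
      intro m
      rw [mul_assoc, ENNReal.mul_div_cancel (hL0 m) (hLt m), Finset.mul_sum, sum_eq_tsum_ite]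
      simp only [hite, ite_mul, zero_mul]
    simp only [h1]
    rw [ENNReal.tsum_comm]
    simp only [ENNReal.tsum_mul_right, ← hFD]
    rfl
  have hsum : ∑' m, D m * L m = radialSum d F := by
    unfold radialSum
    simp only [hFD]
    rw [ENNReal.tsum_comm]
    refine tsum_congr fun m => ?_
    calc D m * L m = ∑ _k ∈ latBall (0 : Lat d) m, D m := by
          rw [Finset.sum_const, card_latBall, nsmul_eq_mul, mul_comm, hL]
          push_cast
          rfl
      _ = _ := by
          rw [sum_eq_tsum_ite]
          simp only [mem_latBall, sub_zero]
  have hstep : ∀ i, radialConv F x i ^ q ≤ radialSum d F ^ (q - 1) *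
      ∑' m, (D m * L m) * ((∑ j ∈ latBall i m, x j) / L m) ^ q := by
    intro i
    rw [hconv, ← hsum]
    exact rpow_tsum_mul_le hW.one_le _ _
  calc energy q W (radialConv F x)
      ≤ ∑' i, radialSum d F ^ (q - 1) *
          (∑' m, (D m * L m) * ((∑ j ∈ latBall i m, x j) / L m) ^ q) * W i :=
        ENNReal.tsum_le_tsum fun i => mul_le_mul_left (hstep i) _
    _ = radialSum d F ^ (q - 1) * ∑' m, (D m * L m) * ((L m ^ q)⁻¹ *
          energy q W (fun i => ∑ j ∈ latBall i m, x j)) := by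
        simp only [mul_assoc, ENNReal.tsum_mul_left]
        congr 1
        simp only [← ENNReal.tsum_mul_right]
        rw [ENNReal.tsum_comm]
        refine tsum_congr fun m => ?_
        simp only [energy, ← ENNReal.tsum_mul_left]
        refine tsum_congr fun i => ?_
        rw [ENNReal.div_rpow_of_nonneg _ _ hq, div_eq_mul_inv]
        ring
    _ ≤ radialSum d F ^ (q - 1) * ∑' m, (D m * L m) *
          (C * (2 ^ d) ^ q * 2 ^ d * energy q W x) := by
        refine mul_le_mul_right (ENNReal.tsum_le_tsum fun m => mul_le_mul_right ?_ _) _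
        refine (mul_le_mul_right (energy_sum_latBall_le hW x m) _).trans (le_of_eq ?_)
        calc (L m ^ q)⁻¹ * (C * (2 ^ d) ^ q * 2 ^ d * L m ^ q * energy q W x)
            = ((L m ^ q)⁻¹ * L m ^ q) * (C * (2 ^ d) ^ q * 2 ^ d * energy q W x) := by ring
          _ = _ := by
            rw [ENNReal.inv_mul_cancel (by simp [hL0 m, hLt m])
              (ENNReal.rpow_ne_top_of_nonneg hq (hLt m)), one_mul]
    _ = _ := by
        rw [ENNReal.tsum_mul_right, hsum]
        have : radialSum d F ^ q = radialSum d F ^ (q - 1) * radialSum d F := by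
          nth_rw 3 [← ENNReal.rpow_one (radialSum d F)]
          rw [← ENNReal.rpow_add_of_nonneg _ _ (by linarith [hW.one_le]) zero_le_one,
            sub_add_cancel]
        rw [this]
        ring

/-! ### Damped kernels of small mass -/

/-- The radial majorant of `k ↦ min (|k| / N, 1) F |k|`. -/
def dampedProfile (F : ℕ → ℝ≥0∞) (N : ℕ) : ℕ → ℝ≥0∞ :=
  fun n => ⨆ (l : ℕ) (_ : n ≤ l), min ((l : ℝ≥0∞) / N) 1 * F l

theorem antitone_dampedProfile (F : ℕ → ℝ≥0∞) (N : ℕ) : Antitone (dampedProfile F N) :=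
  fun _ _ h => iSup_mono fun _ => iSup_mono' fun hn => ⟨h.trans hn, le_rfl⟩

theorem le_dampedProfile (F : ℕ → ℝ≥0∞) (N l : ℕ) :
    min ((l : ℝ≥0∞) / N) 1 * F l ≤ dampedProfile F N l :=
  le_iSup₂_of_le (f := fun (k : ℕ) (_ : l ≤ k) => min ((k : ℝ≥0∞) / N) 1 * F k) l le_rfl le_rfl

theorem dampedProfile_le {F : ℕ → ℝ≥0∞} (hF : Antitone F) (N n : ℕ) :
    dampedProfile F N n ≤ F n :=
  iSup₂_le fun _ hl => (mul_le_of_le_one_left' (min_le_right _ _)).trans (hF hl)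

theorem dampedProfile_le_mul_inv (hd : 1 ≤ d) {F : ℕ → ℝ≥0∞} (hF : Antitone F) (N n : ℕ) :
    dampedProfile F N n ≤ radialSum d F * (N : ℝ≥0∞)⁻¹ := by
  refine iSup₂_le fun l _ => ?_
  calc min ((l : ℝ≥0∞) / N) 1 * F l ≤ (l : ℝ≥0∞) / N * F l := by
        gcongr
        exact min_le_left _ _
    _ = l * F l * (N : ℝ≥0∞)⁻¹ := by rw [div_eq_mul_inv]; ring
    _ ≤ _ := by
        gcongr
        exact natCast_mul_le_radialSum hd hF l

/-- Outside a finite set the tail of $F$ is small uniformly in $N$; on the finite set each value is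
$O(1/N)$, because $nF(n)$ is bounded. -/
theorem exists_radialSum_dampedProfile_le (hd : 1 ≤ d) {F : ℕ → ℝ≥0∞} (hF : Antitone F)
    (hS : radialSum d F ≠ ∞) {ε : ℝ≥0∞} (hε : ε ≠ 0) :
    ∃ N : ℕ, 1 ≤ N ∧ radialSum d (dampedProfile F N) ≤ ε := by
  have hε2 : 0 < ε / 2 := ENNReal.half_pos hε
  have htail := ENNReal.tendsto_tsum_compl_atTop_zero (f := fun k : Lat d => F (latNorm k)) hS
  obtain ⟨s, hs⟩ : ∃ s : Finset (Lat d), ∑' k : {k // k ∉ s}, F (latNorm k.1) ≤ ε / 2 :=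
    (htail.eventually_le_const hε2).exists
  have h : Filter.Tendsto (fun N : ℕ => (s.card * radialSum d F) * (N : ℝ≥0∞)⁻¹) Filter.atTop
      (nhds ((s.card * radialSum d F) * 0)) :=
    ENNReal.Tendsto.const_mul ENNReal.tendsto_inv_nat_nhds_zero
      (Or.inr (ENNReal.mul_ne_top (ENNReal.natCast_ne_top _) hS))
  rw [mul_zero] at h
  obtain ⟨N, hN, hN1⟩ := ((h.eventually_le_const hε2).and (Filter.eventually_ge_atTop 1)).exists
  refine ⟨N, hN1, ?_⟩
  have hsplit : ∑ k ∈ s, dampedProfile F N (latNorm k) +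
      ∑' k : {k // k ∉ s}, dampedProfile F N (latNorm k.1) = radialSum d (dampedProfile F N) := by
    rw [← Finset.tsum_subtype s fun k : Lat d => dampedProfile F N (latNorm k)]
    exact Summable.tsum_add_tsum_compl (s := (s : Set (Lat d)))
      (f := fun k : Lat d => dampedProfile F N (latNorm k)) ENNReal.summable ENNReal.summable
  have h1 : ∑ k ∈ s, dampedProfile F N (latNorm k) ≤ ∑ _k ∈ s, radialSum d F * (N : ℝ≥0∞)⁻¹ :=
    Finset.sum_le_sum fun k _ => dampedProfile_le_mul_inv hd hF _ _
  have h2 : ∑' k : {k // k ∉ s}, dampedProfile F N (latNorm k.1) ≤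
      ∑' k : {k // k ∉ s}, F (latNorm k.1) :=
    ENNReal.tsum_le_tsum fun k => dampedProfile_le hF _ _
  calc radialSum d (dampedProfile F N) = ∑ k ∈ s, dampedProfile F N (latNorm k) +
        ∑' k : {k // k ∉ s}, dampedProfile F N (latNorm k.1) := hsplit.symm
    _ ≤ ε / 2 + ε / 2 := by
        refine add_le_add (h1.trans ?_) (h2.trans hs)
        rw [Finset.sum_const, nsmul_eq_mul, ← mul_assoc]
        exact hN
    _ = ε := ENNReal.add_halves ε

/-! ### Cubes of side N and weighted means over them -/

/-- The index of the cube of side `N` that contains `i`. -/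
def blockIdx (N : ℕ) (i : Lat d) : Lat d := fun t => i t / N

/-- The cube of side `N` with index `m`. -/
def block (N : ℕ) (m : Lat d) : Finset (Lat d) := cube (fun t => N * m t) N

theorem mem_block {N : ℕ} (hN : 1 ≤ N) {m i : Lat d} : i ∈ block N m ↔ blockIdx N i = m := by
  rw [block, mem_cube, funext_iff]
  refine forall_congr' fun t => ?_
  have hN' : (0 : ℤ) < N := by exact_mod_cast hN
  unfold blockIdx
  have h1 := Int.emod_add_mul_ediv (i t) N
  have h2 := Int.emod_nonneg (i t) hN'.ne'
  have h3 := Int.emod_lt_of_pos (i t) hN'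
  constructor
  · rintro ⟨h4, h5⟩
    rw [Int.ediv_eq_iff_of_pos hN']
    constructor <;> rw [mul_comm] <;> omega
  · intro h
    rw [h] at h1
    omega

theorem card_block (N : ℕ) (m : Lat d) : (block N m).card = N ^ d := card_cube _ _

theorem tsum_eq_tsum_sum_block {N : ℕ} (hN : 1 ≤ N) (f : Lat d → ℝ≥0∞) :
    ∑' i, f i = ∑' m, ∑ i ∈ block N m, f i := by
  simp only [sum_eq_tsum_ite]
  rw [ENNReal.tsum_comm]
  simp only [mem_block hN, tsum_ite_eq']

theorem mul_latNorm_blockIdx_sub_le {N : ℕ} (hN : 1 ≤ N) (i j : Lat d) :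
    N * latNorm (blockIdx N i - blockIdx N j) ≤ latNorm (i - j) + (N - 1) := by
  rw [mul_comm, ← Nat.le_div_iff_mul_le (by omega)]
  refine latNorm_le_iff.2 fun t => ?_
  rw [Nat.le_div_iff_mul_le (by omega)]
  have hN' : (0 : ℤ) < N := by exact_mod_cast hN
  have h := natAbs_le_latNorm (i - j) t
  have h1 := Int.emod_add_mul_ediv (i t) N
  have h2 := Int.emod_nonneg (i t) hN'.ne'
  have h3 := Int.emod_lt_of_pos (i t) hN'
  have h4 := Int.emod_add_mul_ediv (j t) N
  have h5 := Int.emod_nonneg (j t) hN'.ne'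
  have h6 := Int.emod_lt_of_pos (j t) hN'
  have h7 : ((blockIdx N i - blockIdx N j) t).natAbs * N = (N * (i t / N) - N * (j t / N)).natAbs := by
    rw [← mul_sub, Int.natAbs_mul, mul_comm]
    rfl
  rw [h7]
  simp only [Pi.sub_apply] at h
  omega

theorem latNorm_sub_le_mul_blockIdx {N : ℕ} (hN : 1 ≤ N) (i j : Lat d) :
    latNorm (i - j) ≤ N * latNorm (blockIdx N i - blockIdx N j) + (N - 1) := by
  refine latNorm_le_iff.2 fun t => ?_
  have hN' : (0 : ℤ) < N := by exact_mod_cast hN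
  have h := Nat.mul_le_mul_left N (natAbs_le_latNorm (blockIdx N i - blockIdx N j) t)
  have h1 := Int.emod_add_mul_ediv (i t) N
  have h2 := Int.emod_nonneg (i t) hN'.ne'
  have h3 := Int.emod_lt_of_pos (i t) hN'
  have h4 := Int.emod_add_mul_ediv (j t) N
  have h5 := Int.emod_nonneg (j t) hN'.ne'
  have h6 := Int.emod_lt_of_pos (j t) hN'
  have h7 : N * ((blockIdx N i - blockIdx N j) t).natAbs = (N * (i t / N) - N * (j t / N)).natAbs := by
    rw [← mul_sub, Int.natAbs_mul]
    rfl
  rw [h7] at h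
  simp only [Pi.sub_apply]
  omega

/-- Every point of the cube with index $m$ has norm below $N(|m|+1)$, so the $N^d$ copies of
$h(N(|m|+1))$ are absorbed by the values of $h$ on that cube. The truncated shift by $4$ is absorbed
by a dilation by $5$, which costs $10^d$. -/
theorem radialSum_blockProfile_le {N : ℕ} (hN : 1 ≤ N) {h : ℕ → ℝ≥0∞} (hh : Antitone h) :
    (N : ℝ≥0∞) ^ d * radialSum d (fun n => h (N * (n - 4 + 1))) ≤ 10 ^ d * radialSum d h := by
  have h0 : Antitone fun n => h (N * (n + 1)) := fun a b hab => hh (by gcongr)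
  have h1 : radialSum d (fun n => h (N * (n - 4 + 1))) ≤
      10 ^ d * radialSum d (fun n => h (N * (n + 1))) := by
    refine (radialSum_mono fun n => comp_sub_le_comp_div h0 n 4).trans ?_
    have := radialSum_comp_div_le (d := d) (fun n => h (N * (n + 1))) (M := 5) (by norm_num)
    norm_num at this
    exact this
  have h2 : (N : ℝ≥0∞) ^ d * radialSum d (fun n => h (N * (n + 1))) ≤ radialSum d h := by
    rw [radialSum, ← ENNReal.tsum_mul_left, radialSum,
      tsum_eq_tsum_sum_block hN fun k => h (latNorm k)]
    refine ENNReal.tsum_le_tsum fun m => ?_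
    calc (N : ℝ≥0∞) ^ d * h (N * (latNorm m + 1)) = ∑ _i ∈ block N m, h (N * (latNorm m + 1)) := by
          simp [card_block]
      _ ≤ _ := Finset.sum_le_sum fun i hi => hh ?_
    have := latNorm_sub_le_mul_blockIdx hN i 0
    have h0 : blockIdx N (0 : Lat d) = 0 := by
      funext t
      simp [blockIdx]
    rw [(mem_block hN).1 hi, h0, sub_zero, sub_zero] at this
    rw [mul_add]
    omega
  calc _ ≤ (N : ℝ≥0∞) ^ d * (10 ^ d * radialSum d (fun n => h (N * (n + 1)))) := by gcongr
    _ = 10 ^ d * ((N : ℝ≥0∞) ^ d * radialSum d (fun n => h (N * (n + 1)))) := by ring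
    _ ≤ _ := by gcongr

/-- The normalized weighted `ℓ^q`-norm on the cube with index `m`. -/
def blockMean (q : ℝ) (W : Lat d → ℝ≥0∞) (N : ℕ) (x : Lat d → ℝ≥0∞) (m : Lat d) : ℝ≥0∞ :=
  ((∑ i ∈ block N m, x i ^ q * W i) / ∑ i ∈ block N m, W i) ^ (1 / q)

section

variable {q : ℝ} {W : Lat d → ℝ≥0∞} {C : ℝ≥0∞} {N : ℕ}

theorem IsCubeWeight.sum_block_ne_zero (hW : IsCubeWeight q W C) (hN : 1 ≤ N) (m : Lat d) :
    ∑ i ∈ block N m, W i ≠ 0 := by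
  have hne : (block N m).Nonempty := Finset.card_pos.1 (by rw [card_block]; positivity)
  obtain ⟨i, hi⟩ := hne
  intro h
  exact hW.ne_zero i (Finset.sum_eq_zero_iff.1 h i hi)

theorem IsCubeWeight.sum_ne_top (hW : IsCubeWeight q W C) (s : Finset (Lat d)) :
    ∑ i ∈ s, W i ≠ ∞ := by
  simp [ENNReal.sum_eq_top, hW.ne_top]

theorem sum_block_eq (hW : IsCubeWeight q W C) (hN : 1 ≤ N) (x : Lat d → ℝ≥0∞) (m : Lat d) :
    ∑ i ∈ block N m, x i ^ q * W i = blockMean q W N x m ^ q * ∑ i ∈ block N m, W i := by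
  have hq : q ≠ 0 := (zero_lt_one.trans_le hW.one_le).ne'
  rw [blockMean, ← ENNReal.rpow_mul, one_div_mul_cancel hq, ENNReal.rpow_one,
    ENNReal.div_mul_cancel (hW.sum_block_ne_zero hN m) (hW.sum_ne_top _)]

/-- The cube condition divided by the weight of the cube. It lets unweighted sums be controlled by
weighted means, and later removes the weight from the final bound. -/
theorem sum_block_le_blockMean (hW : IsCubeWeight q W C) (hN : 1 ≤ N) (x : Lat d → ℝ≥0∞)
    (m : Lat d) : ∑ i ∈ block N m, x i ≤ C ^ (1 / q) * ((N : ℝ≥0∞) ^ d * blockMean q W N x m) := by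
  have hq : 0 < q := zero_lt_one.trans_le hW.one_le
  have h := hW.le (fun t => N * m t) N hN x
  change (∑ i ∈ block N m, x i) ^ q * ∑ i ∈ block N m, W i ≤
    C * ((N : ℝ≥0∞) ^ d) ^ q * ∑ i ∈ block N m, x i ^ q * W i at h
  rw [sum_block_eq hW hN, ← mul_assoc,
    ENNReal.mul_le_mul_iff_left (hW.sum_block_ne_zero hN m) (hW.sum_ne_top _)] at h
  have h2 := ENNReal.rpow_le_rpow h (show 0 ≤ 1 / q by positivity)
  rw [← ENNReal.rpow_mul, mul_one_div_cancel hq.ne', ENNReal.rpow_one,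
    ENNReal.mul_rpow_of_nonneg _ _ (by positivity), ENNReal.mul_rpow_of_nonneg _ _ (by positivity),
    ← ENNReal.rpow_mul, ← ENNReal.rpow_mul, mul_one_div_cancel hq.ne', ENNReal.rpow_one,
    ENNReal.rpow_one, mul_assoc] at h2
  exact h2

theorem blockMean_le_of_le (hW : IsCubeWeight q W C) {x : Lat d → ℝ≥0∞}
    {M : ℝ≥0∞} {m : Lat d} (hx : ∀ i ∈ block N m, x i ≤ M) : blockMean q W N x m ≤ M := by
  have hq : 0 < q := zero_lt_one.trans_le hW.one_le
  have h : (∑ i ∈ block N m, x i ^ q * W i) / ∑ i ∈ block N m, W i ≤ M ^ q := by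
    refine ENNReal.div_le_of_le_mul ?_
    rw [Finset.mul_sum]
    gcongr with i hi
    exact hx i hi
  refine (ENNReal.rpow_le_rpow h (by positivity)).trans ?_
  rw [← ENNReal.rpow_mul, mul_one_div_cancel hq.ne', ENNReal.rpow_one]

/-- Doubling: the cubes whose index is at distance at most three from `m` have comparable total
weight. -/
theorem sum_weight_near_le (hW : IsCubeWeight q W C) (hN : 1 ≤ N) (m : Lat d)
    (s : Finset (Lat d)) (hs : ∀ i ∈ s, latNorm (blockIdx N i - m) ≤ 3) :
    ∑ i ∈ s, W i ≤ C * (7 ^ d) ^ q * ∑ i ∈ block N m, W i := by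
  have hq : 0 < q := zero_lt_one.trans_le hW.one_le
  have hN' : (0 : ℤ) < N := by exact_mod_cast hN
  set P := cube (fun t => (N : ℤ) * (m t - 3)) (7 * N) with hP
  have hmem : ∀ i, latNorm (blockIdx N i - m) ≤ 3 → i ∈ P := by
    intro i hi
    rw [hP, mem_cube]
    intro t
    have h := (natAbs_le_latNorm (blockIdx N i - m) t).trans hi
    simp only [Pi.sub_apply, blockIdx] at h
    have h1 := Int.emod_add_mul_ediv (i t) N
    have h2 := Int.emod_nonneg (i t) hN'.ne'
    have h3 := Int.emod_lt_of_pos (i t) hN'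
    have h4 : (N : ℤ) * (m t - 3) ≤ N * (i t / N) := mul_le_mul_of_nonneg_left (by omega) hN'.le
    have h5 : (N : ℤ) * (i t / N) ≤ N * (m t - 3 + 6) := mul_le_mul_of_nonneg_left (by omega) hN'.le
    rw [mul_add] at h5
    push_cast
    omega
  have hblock : block N m ⊆ P := fun i hi => hmem i (by
    rw [(mem_block hN).1 hi, sub_self, latNorm_zero]
    omega)
  -- Testing the condition with the indicator of one cube, inside the cube of side $7N$ made of its
  -- neighbours up to index distance three, gives doubling.
  have h := hW.le (fun t => (N : ℤ) * (m t - 3)) (7 * N) (by omega)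
    (fun i => if i ∈ block N m then 1 else 0)
  rw [← hP] at h
  have hinter : P ∩ block N m = block N m := Finset.inter_eq_right.2 hblock
  have e1 : ∀ i, (if i ∈ block N m then (1 : ℝ≥0∞) else 0) ^ q * W i =
      if i ∈ block N m then W i else 0 := fun i => by
    split_ifs <;> simp [hq]
  simp only [e1, Finset.sum_ite_mem, hinter, Finset.sum_const, card_block, nsmul_eq_mul,
    mul_one] at h
  have hL0 : (((N : ℝ≥0∞) ^ d) ^ q) ≠ 0 := by
    have : (N : ℝ≥0∞) ^ d ≠ 0 := pow_ne_zero _ (by norm_cast; omega)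
    simp [this]
  have hLt : (((N : ℝ≥0∞) ^ d) ^ q) ≠ ∞ :=
    ENNReal.rpow_ne_top_of_nonneg hq.le (ENNReal.pow_ne_top (ENNReal.natCast_ne_top _))
  refine (Finset.sum_le_sum_of_subset fun i hi => hmem i (hs i hi)).trans ?_
  rw [← ENNReal.mul_le_mul_iff_right hL0 hLt]
  push_cast at h
  refine h.trans (le_of_eq ?_)
  rw [mul_pow, ENNReal.mul_rpow_of_nonneg _ _ hq.le]
  ring

end

/-! ### The localized energy estimate -/

theorem tsum_rpow_le_rpow_tsum {ι : Type*} {q : ℝ} (hq : 1 ≤ q) (a : ι → ℝ≥0∞) :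
    ∑' i, a i ^ q ≤ (∑' i, a i) ^ q := by
  have h : ∀ b : ℝ≥0∞, b ^ q = b * b ^ (q - 1) := fun b => by
    nth_rw 2 [← ENNReal.rpow_one b]
    rw [← ENNReal.rpow_add_of_nonneg _ _ zero_le_one (by linarith), add_sub_cancel]
  rw [h (∑' i, a i), ← ENNReal.tsum_mul_right]
  refine ENNReal.tsum_le_tsum fun i => ?_
  rw [h]
  exact mul_le_mul_right (ENNReal.rpow_le_rpow (ENNReal.le_tsum i) (by linarith)) _

theorem add_add_rpow_le {q : ℝ} (hq : 0 ≤ q) (a b c : ℝ≥0∞) :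
    (a + b + c) ^ q ≤ 3 ^ q * (a ^ q + b ^ q + c ^ q) := by
  have h : a + b + c ≤ 3 * max (max a b) c := by
    calc a + b + c ≤ max (max a b) c + max (max a b) c + max (max a b) c := by
          gcongr <;> simp
      _ = _ := by ring
  refine (ENNReal.rpow_le_rpow h hq).trans ?_
  rw [ENNReal.mul_rpow_of_nonneg _ _ hq]
  gcongr
  rcases max_choice (max a b) c with h1 | h1 <;> rw [h1]
  · rcases max_choice a b with h2 | h2 <;> rw [h2]
    · exact le_add_right (le_add_right le_rfl)
    · exact le_add_right (le_add_left le_rfl)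
  · exact le_add_left le_rfl

/-- The radial sequence equal to one up to distance `r`. -/
def radialInd (r n : ℕ) : ℝ≥0∞ := if n ≤ r then 1 else 0

theorem antitone_radialInd (r : ℕ) : Antitone (radialInd r) := by
  intro m n h
  unfold radialInd
  split_ifs with h1 h2 <;> first | omega | simp

theorem radialSum_radialInd (r : ℕ) : radialSum d (radialInd r) = (2 * r + 1) ^ d := by
  have h : ∀ k : Lat d, radialInd r (latNorm k) = if k ∈ latBall 0 r then 1 else 0 := fun k => by
    simp only [radialInd, mem_latBall, sub_zero]
  simp only [radialSum, h]
  rw [← sum_eq_tsum_ite, Finset.sum_const, card_latBall]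
  simp

section

variable {q : ℝ} {W : Lat d → ℝ≥0∞} {C : ℝ≥0∞} {N : ℕ}

/-- Doubling replaces the weight of each nearby cube by that of cube $m$, and the sum of $q$-th
powers of the means is at most the $q$-th power of their sum. -/
theorem energy_near_le (hW : IsCubeWeight q W C) (hN : 1 ≤ N) (m : Lat d) {r : ℕ} (hr : r ≤ 3)
    (x : Lat d → ℝ≥0∞) :
    energy q W (fun i => if latNorm (blockIdx N i - m) ≤ r then x i else 0) ≤
      C * (7 ^ d) ^ q * (∑ i ∈ block N m, W i) *
        radialConv (radialInd r) (blockMean q W N x) m ^ q := by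
  have hq : 0 < q := zero_lt_one.trans_le hW.one_le
  calc energy q W (fun i => if latNorm (blockIdx N i - m) ≤ r then x i else 0)
      = ∑' l, radialInd r (latNorm (m - l)) * ∑ i ∈ block N l, x i ^ q * W i := by
        rw [energy, tsum_eq_tsum_sum_block hN]
        refine tsum_congr fun l => ?_
        rw [Finset.mul_sum]
        refine Finset.sum_congr rfl fun i hi => ?_
        rw [(mem_block hN).1 hi, latNorm_sub_comm m l, radialInd]
        split_ifs <;> simp [hq]
    _ ≤ ∑' l, C * (7 ^ d) ^ q * (∑ i ∈ block N m, W i) *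
          (radialInd r (latNorm (m - l)) * blockMean q W N x l) ^ q := by
        refine ENNReal.tsum_le_tsum fun l => ?_
        rw [sum_block_eq hW hN]
        unfold radialInd
        split_ifs with h
        · rw [one_mul, one_mul, mul_comm]
          gcongr
          refine sum_weight_near_le hW hN m _ fun i hi => ?_
          rw [(mem_block hN).1 hi, latNorm_sub_comm]
          omega
        · simp
    _ ≤ _ := by
        rw [ENNReal.tsum_mul_left]
        gcongr
        exact tsum_rpow_le_rpow_tsum hW.one_le _

/-- The kernel that bounds a commutator with a cutoff function at scale `N`. -/
def commutatorProfile (d : ℕ) (h : ℕ → ℝ≥0∞) (N : ℕ) : ℕ → ℝ≥0∞ := fun n =>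
  radialSum d h * radialInd 3 n + (N : ℝ≥0∞) ^ d * h (N * (n - 4 + 1))

theorem antitone_commutatorProfile {h : ℕ → ℝ≥0∞} (hh : Antitone h) (N : ℕ) :
    Antitone (commutatorProfile d h N) := fun a b hab =>
  add_le_add (mul_le_mul_right (antitone_radialInd 3 hab) _)
    (mul_le_mul_right (hh (Nat.mul_le_mul_left N (by omega))) _)

theorem radialSum_commutatorProfile_le (hN : 1 ≤ N) {h : ℕ → ℝ≥0∞} (hh : Antitone h) :
    radialSum d (commutatorProfile d h N) ≤ (7 ^ d + 10 ^ d) * radialSum d h := by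
  unfold commutatorProfile
  rw [radialSum_add, radialSum_const_mul, radialSum_const_mul, radialSum_radialInd, add_mul]
  refine add_le_add (le_of_eq ?_) (radialSum_blockProfile_le hN hh)
  norm_num [mul_comm]

/-- Split $x$ by index distance from $m$. The near part (at most $3$) is handled by boundedness of
convolution with $h$ on the weighted space. A far $j$ contributes only for $i$ within $2$ of $m$,
and there $h(|i-j|)$ has a bound depending only on the cube of $j$, so the far part is dominated by
a constant $T$ near cube $m$. The prefactor apart from the weight of cube $m$ does not involve $N$.
-/
theorem energy_le_of_le_commutator (hd : 1 ≤ d) (hW : IsCubeWeight q W C) (hN : 1 ≤ N)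
    {h : ℕ → ℝ≥0∞} (hh : Antitone h) (hS : radialSum d h ≠ ∞) (m : Lat d) (x y z : Lat d → ℝ≥0∞)
    (hz : ∀ i, z i ≤ (if latNorm (blockIdx N i - m) ≤ 2 then y i else 0) +
      ∑' j, (if latNorm (blockIdx N i - m) ≤ 2 ∨ latNorm (blockIdx N j - m) ≤ 2 then
        h (latNorm (i - j)) else 0) * x j) :
    energy q W z ≤ 3 ^ q * (C * (7 ^ d) ^ q) * (1 + C * (2 ^ d) ^ q * 2 ^ d + C) *
      (∑ i ∈ block N m, W i) * (radialConv (radialInd 2) (blockMean q W N y) m +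
        radialConv (commutatorProfile d h N) (blockMean q W N x) m) ^ q := by
  have hq : 0 < q := zero_lt_one.trans_le hW.one_le
  set T : ℝ≥0∞ := ∑' l, h (N * (latNorm (m - l) - 4 + 1)) * ∑ j ∈ block N l, x j with hT
  set w : ℝ≥0∞ := ∑ i ∈ block N m, W i with hw
  set near : Lat d → ℝ≥0∞ := fun j => if latNorm (blockIdx N j - m) ≤ 3 then x j else 0 with hnear
  set R : ℝ≥0∞ := radialConv (radialInd 2) (blockMean q W N y) m +
        radialConv (commutatorProfile d h N) (blockMean q W N x) m with hR
  have hconv : radialConv (commutatorProfile d h N) (blockMean q W N x) m =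
      radialSum d h * radialConv (radialInd 3) (blockMean q W N x) m +
      (N : ℝ≥0∞) ^ d * ∑' l, h (N * (latNorm (m - l) - 4 + 1)) * blockMean q W N x l := by
    unfold radialConv commutatorProfile
    rw [← ENNReal.tsum_mul_left, ← ENNReal.tsum_mul_left, ← ENNReal.tsum_add]
    exact tsum_congr fun l => by ring
  have hpt : ∀ i, z i ≤ (if latNorm (blockIdx N i - m) ≤ 2 then y i else 0) +
      radialConv h near i + (if latNorm (blockIdx N i - m) ≤ 2 then T else 0) := by
    intro i
    refine (hz i).trans ?_
    rw [add_assoc]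
    gcongr
    have hTi : (if latNorm (blockIdx N i - m) ≤ 2 then T else 0) =
        ∑' j, (if latNorm (blockIdx N i - m) ≤ 2 then
          h (N * (latNorm (m - blockIdx N j) - 4 + 1)) * x j else 0) := by
      split_ifs with hi
      · rw [tsum_eq_tsum_sum_block hN, hT]
        refine tsum_congr fun l => ?_
        rw [Finset.mul_sum]
        refine Finset.sum_congr rfl fun j hj => ?_
        rw [(mem_block hN).1 hj]
      · simp
    rw [hTi, radialConv, ← ENNReal.tsum_add]
    refine ENNReal.tsum_le_tsum fun j => ?_
    rw [hnear]
    dsimp only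
    by_cases hj : latNorm (blockIdx N j - m) ≤ 3
    · rw [if_pos hj]
      refine le_add_right ?_
      gcongr
      split_ifs <;> simp
    · rw [if_neg hj, mul_zero, zero_add]
      by_cases hi : latNorm (blockIdx N i - m) ≤ 2
      · rw [if_pos (Or.inl hi), if_pos hi]
        gcongr
        apply hh
        -- The cubes of $i$ and $j$ have index distance at least $|m-l|-2$, with $l$ the index of
        -- the cube of $j$. Passing to points loses at most $N-1$, so $|i-j|\ge N(|m-l|-3)$; as
        -- $|m-l|\ge4$, truncation in the subtraction is harmless.
        have h1 := mul_latNorm_blockIdx_sub_le hN i j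
        have h2 := latNorm_sub_le m (blockIdx N i) (blockIdx N j)
        rw [latNorm_sub_comm m (blockIdx N i)] at h2
        have h3 : N * (latNorm (m - blockIdx N j) - 4 + 1 + 1) ≤
            N * latNorm (blockIdx N i - blockIdx N j) := by
          rw [latNorm_sub_comm (blockIdx N j) m] at hj
          exact Nat.mul_le_mul_left N (by omega)
        rw [mul_add _ _ 1] at h3
        omega
      · have hn : ¬ (latNorm (blockIdx N i - m) ≤ 2 ∨ latNorm (blockIdx N j - m) ≤ 2) := by
          omega
        rw [if_neg hn]
        simp
  have hA : energy q W (fun i => if latNorm (blockIdx N i - m) ≤ 2 then y i else 0) ≤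
      C * (7 ^ d) ^ q * w * R ^ q := by
    refine (energy_near_le hW hN m (by norm_num) y).trans ?_
    gcongr
    exact le_add_right le_rfl
  have hB : energy q W (radialConv h near) ≤
      C * (2 ^ d) ^ q * 2 ^ d * (C * (7 ^ d) ^ q * w * R ^ q) := by
    refine (energy_radialConv_le hd hW hh hS near).trans ?_
    rw [mul_assoc (C * (2 ^ d) ^ q * 2 ^ d)]
    refine mul_le_mul_right ?_ _
    refine (mul_le_mul_right (energy_near_le hW hN m le_rfl x) _).trans ?_
    rw [mul_left_comm, ← hw, ← ENNReal.mul_rpow_of_nonneg _ _ hq.le]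
    gcongr
    rw [hR, hconv]
    exact le_add_left (le_add_right le_rfl)
  have hTR : T ^ q ≤ C * R ^ q := by
    have h1 : T ≤ C ^ (1 / q) * R := by
      calc T ≤ ∑' l, h (N * (latNorm (m - l) - 4 + 1)) *
            (C ^ (1 / q) * ((N : ℝ≥0∞) ^ d * blockMean q W N x l)) := by
            refine ENNReal.tsum_le_tsum fun l => mul_le_mul_right ?_ _
            exact sum_block_le_blockMean hW hN x l
        _ = C ^ (1 / q) * ((N : ℝ≥0∞) ^ d *
              ∑' l, h (N * (latNorm (m - l) - 4 + 1)) * blockMean q W N x l) := by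
            rw [← ENNReal.tsum_mul_left, ← ENNReal.tsum_mul_left]
            exact tsum_congr fun l => by ring
        _ ≤ _ := by
            gcongr
            rw [hR, hconv]
            exact le_add_left (le_add_left le_rfl)
    refine (ENNReal.rpow_le_rpow h1 hq.le).trans (le_of_eq ?_)
    rw [ENNReal.mul_rpow_of_nonneg _ _ hq.le, ← ENNReal.rpow_mul, one_div_mul_cancel hq.ne',
      ENNReal.rpow_one]
  have hC : energy q W (fun i => if latNorm (blockIdx N i - m) ≤ 2 then T else 0) ≤
      C * (C * (7 ^ d) ^ q * w * R ^ q) := by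
    have h1 : energy q W (fun i => if latNorm (blockIdx N i - m) ≤ 2 then T else 0) ≤
        T ^ q * (C * (7 ^ d) ^ q * w) := by
      rw [energy, ENNReal.tsum_eq_iSup_sum]
      refine iSup_le fun s => ?_
      have h2 : ∀ i, (if latNorm (blockIdx N i - m) ≤ 2 then T else 0) ^ q * W i =
          if latNorm (blockIdx N i - m) ≤ 2 then T ^ q * W i else 0 := fun i => by
        split_ifs <;> simp [hq]
      simp only [h2]
      rw [← Finset.sum_filter, ← Finset.mul_sum]
      gcongr
      refine sum_weight_near_le hW hN m _ fun i hi => ?_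
      have := (Finset.mem_filter.1 hi).2
      omega
    refine h1.trans ((mul_le_mul_left hTR _).trans (le_of_eq ?_))
    ring
  calc energy q W z ≤ ∑' i, 3 ^ q * (((if latNorm (blockIdx N i - m) ≤ 2 then y i else 0) ^ q +
        radialConv h near i ^ q + (if latNorm (blockIdx N i - m) ≤ 2 then T else 0) ^ q) * W i) := by
        refine ENNReal.tsum_le_tsum fun i => ?_
        rw [← mul_assoc]
        gcongr
        exact (ENNReal.rpow_le_rpow (hpt i) hq.le).trans (add_add_rpow_le hq.le _ _ _)
    _ = 3 ^ q * (energy q W (fun i => if latNorm (blockIdx N i - m) ≤ 2 then y i else 0) +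
          energy q W (radialConv h near) +
          energy q W (fun i => if latNorm (blockIdx N i - m) ≤ 2 then T else 0)) := by
        rw [ENNReal.tsum_mul_left, energy, energy, energy, ← ENNReal.tsum_add, ← ENNReal.tsum_add]
        simp only [add_mul]
    _ ≤ 3 ^ q * (C * (7 ^ d) ^ q * w * R ^ q + C * (2 ^ d) ^ q * 2 ^ d *
          (C * (7 ^ d) ^ q * w * R ^ q) + C * (C * (7 ^ d) ^ q * w * R ^ q)) := by
        gcongr
    _ = _ := by ring

end

/-! ### Cutoffs and commutators -/

/-- A Lipschitz cutoff function that is one on the cube of side `N` with index `m`. -/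
def cutoff (N : ℕ) (m i : Lat d) : ℝ :=
  max 0 (min 1 (2 - (latNorm (i - fun t => N * m t) : ℝ) / N))

theorem cutoff_nonneg (N : ℕ) (m i : Lat d) : 0 ≤ cutoff N m i := le_max_left _ _

theorem cutoff_le_one (N : ℕ) (m i : Lat d) : cutoff N m i ≤ 1 :=
  max_le zero_le_one (min_le_left _ _)

theorem blockIdx_corner {N : ℕ} (hN : 1 ≤ N) (m : Lat d) :
    blockIdx N (fun t => N * m t : Lat d) = m := by
  funext t
  have hN' : (N : ℤ) ≠ 0 := by exact_mod_cast (by omega : N ≠ 0)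
  exact Int.mul_ediv_cancel_left _ hN'

theorem cutoff_eq_one {N : ℕ} (hN : 1 ≤ N) {m i : Lat d} (hi : i ∈ block N m) :
    cutoff N m i = 1 := by
  have h := latNorm_sub_le_mul_blockIdx hN i (fun t => N * m t)
  rw [blockIdx_corner hN, (mem_block hN).1 hi, sub_self, latNorm_zero] at h
  have h1 : latNorm (i - fun t => (N : ℤ) * m t) ≤ N := by omega
  have hN' : (0 : ℝ) < N := by exact_mod_cast hN
  have h2 : (latNorm (i - fun t => (N : ℤ) * m t) : ℝ) / N ≤ 1 := by
    rw [div_le_one hN']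
    exact_mod_cast h1
  rw [cutoff, min_eq_left (by linarith), max_eq_right zero_le_one]

theorem cutoff_eq_zero {N : ℕ} (hN : 1 ≤ N) {m i : Lat d}
    (hi : ¬ latNorm (blockIdx N i - m) ≤ 2) : cutoff N m i = 0 := by
  have h := mul_latNorm_blockIdx_sub_le hN i (fun t => N * m t)
  rw [blockIdx_corner hN] at h
  have h3 : N * 3 ≤ N * latNorm (blockIdx N i - m) := Nat.mul_le_mul_left N (by omega)
  have h1 : 2 * N ≤ latNorm (i - fun t => (N : ℤ) * m t) := by omega
  have hN' : (0 : ℝ) < N := by exact_mod_cast hN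
  have h2 : 2 ≤ (latNorm (i - fun t => (N : ℤ) * m t) : ℝ) / N := by
    rw [le_div_iff₀ hN']
    exact_mod_cast h1
  rw [cutoff, max_eq_left]
  exact (min_le_right _ _).trans (by linarith)

theorem enorm_cutoff_sub_le (N : ℕ) (m i j : Lat d) :
    ‖cutoff N m j - cutoff N m i‖ₑ ≤ min ((latNorm (i - j) : ℝ≥0∞) / N) 1 := by
  -- For $N=0$ real division by zero gives $0$, so the cutoff is constantly one.
  rcases Nat.eq_zero_or_pos N with rfl | hN
  · simp [cutoff]
  have hN' : (0 : ℝ) < N := by exact_mod_cast hN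
  have h1 : |cutoff N m j - cutoff N m i| ≤ 1 := by
    have := cutoff_nonneg N m i
    have := cutoff_nonneg N m j
    have := cutoff_le_one N m i
    have := cutoff_le_one N m j
    rw [abs_le]
    constructor <;> linarith
  have h2 : |cutoff N m j - cutoff N m i| ≤ (latNorm (i - j) : ℝ) / N := by
    unfold cutoff
    set a := latNorm (i - fun t => (N : ℤ) * m t)
    set b := latNorm (j - fun t => (N : ℤ) * m t)
    have e1 : a ≤ latNorm (i - j) + b := latNorm_sub_le _ _ _
    have e2 : b ≤ latNorm (i - j) + a := by
      rw [latNorm_sub_comm i j]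
      exact latNorm_sub_le _ _ _
    have hab : |(b : ℝ) - a| ≤ latNorm (i - j) := by
      rw [abs_le]
      have e1' : (a : ℝ) ≤ latNorm (i - j) + b := by exact_mod_cast e1
      have e2' : (b : ℝ) ≤ latNorm (i - j) + a := by exact_mod_cast e2
      constructor <;> linarith
    calc _ ≤ |min 1 (2 - (b : ℝ) / N) - min 1 (2 - (a : ℝ) / N)| := by
          have := abs_max_sub_max_le_max (0 : ℝ) (min 1 (2 - (b : ℝ) / N)) 0
            (min 1 (2 - (a : ℝ) / N))
          simpa using this
      _ ≤ |(2 - (b : ℝ) / N) - (2 - (a : ℝ) / N)| := by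
          have := abs_min_sub_min_le_max (1 : ℝ) (2 - (b : ℝ) / N) 1 (2 - (a : ℝ) / N)
          simpa using this
      _ = |(b : ℝ) - a| / N := by
          rw [← abs_of_pos hN', ← abs_div, abs_of_pos hN', abs_sub_comm]
          congr 1
          ring
      _ ≤ _ := by gcongr
  rw [Real.enorm_eq_ofReal_abs, ← ENNReal.ofReal_natCast, ← ENNReal.ofReal_natCast,
    ← ENNReal.ofReal_div_of_pos hN', ← ENNReal.ofReal_one]
  exact le_min (ENNReal.ofReal_le_ofReal h2) (ENNReal.ofReal_le_ofReal h1)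

theorem summable_of_tsum_enorm_ne_top {ι : Type*} {f : ι → ℂ} (h : ∑' i, ‖f i‖ₑ ≠ ∞) :
    Summable f :=
  Summable.of_nnnorm (ENNReal.tsum_coe_ne_top_iff_summable.1 h)

theorem tsum_enorm_mul_le (A : InfMatrix d) (c : Lat d → ℂ) (i : Lat d) :
    ∑' j, ‖A i j * c j‖ₑ ≤ radialConv (radialProfile A) (fun j => ‖c j‖ₑ) i := by
  refine ENNReal.tsum_le_tsum fun j => ?_
  rw [enorm_mul]
  gcongr
  exact enorm_le_radialProfile A i j

theorem summable_mul_of_radialConv_ne_top {A : InfMatrix d} {c : Lat d → ℂ} {i : Lat d}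
    (h : radialConv (radialProfile A) (fun j => ‖c j‖ₑ) i ≠ ∞) : Summable fun j => A i j * c j :=
  summable_of_tsum_enorm_ne_top (ne_top_of_le_ne_top h (tsum_enorm_mul_le A c i))

theorem enorm_mulSeq_le (A : InfMatrix d) (c : Lat d → ℂ) (i : Lat d) :
    ‖mulSeq A c i‖ₑ ≤ radialConv (radialProfile A) (fun j => ‖c j‖ₑ) i :=
  enorm_tsum_le_tsum_enorm.trans (tsum_enorm_mul_le A c i)

theorem radialConv_ne_top_of_le {F : ℕ → ℝ≥0∞} (hS : radialSum d F ≠ ∞) {x : Lat d → ℝ≥0∞}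
    {M : ℝ≥0∞} (hM : M ≠ ∞) (hx : ∀ i, x i ≤ M) (i : Lat d) : radialConv F x i ≠ ∞ := by
  refine ne_top_of_le_ne_top (ENNReal.mul_ne_top hS hM) ?_
  rw [← radialConv_const F M i]
  exact radialConv_mono (fun _ => le_rfl) hx i

/-- The commutator of $A$ with the cutoff has entries $a(i,j)(\varphi(j)-\varphi(i))$. The Lipschitz
bound damps them, and they vanish when both points lie off the support. -/
theorem enorm_mulSeq_cutoff_le {A : InfMatrix d} (hS : radialSum d (radialProfile A) ≠ ∞)
    {N : ℕ} (hN : 1 ≤ N) (m : Lat d) {c : Lat d → ℂ} {M : ℝ≥0∞} (hM : M ≠ ∞)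
    (hc : ∀ i, ‖c i‖ₑ ≤ M) (i : Lat d) :
    ‖mulSeq A (fun j => (cutoff N m j : ℂ) * c j) i‖ₑ ≤
      (if latNorm (blockIdx N i - m) ≤ 2 then ‖mulSeq A c i‖ₑ else 0) +
      ∑' j, (if latNorm (blockIdx N i - m) ≤ 2 ∨ latNorm (blockIdx N j - m) ≤ 2 then
        dampedProfile (radialProfile A) N (latNorm (i - j)) else 0) * ‖c j‖ₑ := by
  have hcut : ∀ j, ‖(cutoff N m j : ℂ)‖ₑ ≤ 1 := fun j => by
    rw [← ofReal_norm, Complex.norm_real, Real.norm_of_nonneg (cutoff_nonneg _ _ _)]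
    simpa using cutoff_le_one N m j
  have hs1 : Summable fun j => A i j * c j :=
    summable_mul_of_radialConv_ne_top (radialConv_ne_top_of_le hS hM hc i)
  have hs2 : Summable fun j => A i j * ((cutoff N m j : ℂ) * c j) := by
    refine summable_mul_of_radialConv_ne_top (radialConv_ne_top_of_le hS hM (fun j => ?_) i)
    rw [enorm_mul]
    exact (mul_le_of_le_one_left' (hcut j)).trans (hc j)
  have hsplit : mulSeq A (fun j => (cutoff N m j : ℂ) * c j) i = (cutoff N m i : ℂ) * mulSeq A c i +
      ∑' j, A i j * (((cutoff N m j - cutoff N m i : ℝ) : ℂ) * c j) := by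
    rw [mulSeq, mulSeq, ← tsum_mul_left, ← (hs1.mul_left _).tsum_add]
    · exact tsum_congr fun j => by push_cast; ring
    · refine (hs2.sub (hs1.mul_left (cutoff N m i : ℂ))).congr fun j => ?_
      push_cast
      ring
  rw [hsplit]
  refine (enorm_add_le _ _).trans (add_le_add ?_ ?_)
  · rw [enorm_mul]
    split_ifs with hi
    · exact mul_le_of_le_one_left' (hcut i)
    · simp [cutoff_eq_zero hN hi]
  · refine enorm_tsum_le_tsum_enorm.trans (ENNReal.tsum_le_tsum fun j => ?_)
    rw [enorm_mul, enorm_mul, ← mul_assoc]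
    gcongr
    split_ifs with hij
    · refine le_trans ?_ (le_dampedProfile _ _ _)
      rw [mul_comm, ← ofReal_norm (((cutoff N m j - cutoff N m i : ℝ) : ℂ)), Complex.norm_real,
        ofReal_norm]
      exact mul_le_mul' (enorm_cutoff_sub_le N m i j) (enorm_le_radialProfile A i j)
    · rw [not_or] at hij
      simp [cutoff_eq_zero hN hij.1, cutoff_eq_zero hN hij.2]

/-! ### From stability in one space to a pointwise bound -/

theorem weightedNorm_eq {q : ℝ} (hq : 0 ≤ q) (w : Lat d → ℝ) (c : Lat d → ℂ) :
    weightedNorm q w c =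
      energy q (fun i => ENNReal.ofReal (w i)) (fun i => ‖c i‖ₑ) ^ (1 / q) := by
  rw [weightedNorm, energy]
  congr 1
  refine tsum_congr fun i => ?_
  rw [ENNReal.ofReal_mul (by positivity), ← ENNReal.ofReal_rpow_of_nonneg (norm_nonneg _) hq,
    ofReal_norm]

theorem weightedNorm_lt_top_iff {q : ℝ} (hq : 1 ≤ q) (w : Lat d → ℝ) (c : Lat d → ℂ) :
    weightedNorm q w c < ∞ ↔
      energy q (fun i => ENNReal.ofReal (w i)) (fun i => ‖c i‖ₑ) < ∞ := by
  rw [weightedNorm_eq (by linarith), ENNReal.rpow_lt_top_iff_of_pos (by positivity)]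

/-- Only the lower stability bound is extracted; upper bounds come from the radial profile. -/
theorem HasStability.exists_energy_le {A : InfMatrix d} {q : ℝ} (hq : 1 ≤ q) {w : Lat d → ℝ}
    (h : HasStability A q w) : ∃ K : ℝ≥0∞, K ≠ ∞ ∧ ∀ c : Lat d → ℂ,
      energy q (fun i => ENNReal.ofReal (w i)) (fun i => ‖c i‖ₑ) < ∞ →
      energy q (fun i => ENNReal.ofReal (w i)) (fun i => ‖c i‖ₑ) ≤
        K ^ q * energy q (fun i => ENNReal.ofReal (w i)) (fun i => ‖mulSeq A c i‖ₑ) := by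
  obtain ⟨K, hK, h⟩ := h
  have hq0 : 0 < q := by linarith
  refine ⟨K, ENNReal.coe_ne_top, fun c hc => ?_⟩
  have h1 := (h c ((weightedNorm_lt_top_iff hq w c).2 hc)).2.1
  rw [ENNReal.coe_inv hK.ne', ENNReal.inv_mul_le_iff (by simpa using hK.ne') ENNReal.coe_ne_top,
    weightedNorm_eq hq0.le, weightedNorm_eq hq0.le] at h1
  have h2 := ENNReal.rpow_le_rpow h1 hq0.le
  rwa [ENNReal.mul_rpow_of_nonneg _ _ hq0.le, ← ENNReal.rpow_mul, ← ENNReal.rpow_mul,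
    one_div_mul_cancel hq0.ne', ENNReal.rpow_one, ENNReal.rpow_one] at h2

theorem energy_lt_top_of_finite_support {q : ℝ} (hq : 0 < q) {W x : Lat d → ℝ≥0∞}
    (hW : ∀ i, W i ≠ ∞) (hx : ∀ i, x i ≠ ∞) (s : Finset (Lat d)) (hs : ∀ i ∉ s, x i = 0) :
    energy q W x < ∞ := by
  rw [energy, tsum_eq_sum (s := s) fun i hi => by simp [hs i hi, hq]]
  exact ENNReal.sum_lt_top.2 fun i _ => ENNReal.mul_lt_top
    (ENNReal.rpow_lt_top_of_nonneg hq.le (hx i)) (hW i).lt_top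

/-- The inverse of a stable matrix on bounded sequences is dominated by convolution with a
summable radially decreasing sequence. -/
theorem HasStability.exists_radial_majorant (hd : 1 ≤ d) {A : InfMatrix d}
    (hS : radialSum d (radialProfile A) < ∞) {q : ℝ} (hq : 1 ≤ q) {w : Lat d → ℝ}
    (hw : IsDiscreteAq q w) (hstab : HasStability A q w) :
    ∃ G : ℕ → ℝ≥0∞, Antitone G ∧ radialSum d G < ∞ ∧
      ∀ (c : Lat d → ℂ) (M : ℝ≥0∞), M ≠ ∞ → (∀ i, ‖c i‖ₑ ≤ M) →
        ∀ i, ‖c i‖ₑ ≤ radialConv G (fun j => ‖mulSeq A c j‖ₑ) i := by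
  have hq0 : 0 < q := by linarith
  obtain ⟨C, hW⟩ := hw.exists_isCubeWeight hq
  obtain ⟨K, hK, hstab⟩ := hstab.exists_energy_le hq
  set W : Lat d → ℝ≥0∞ := fun i => ENNReal.ofReal (w i)
  -- `B` and `R` depend on $q$, $d$, $C$, $K$ but not on the scale, so $N$ can be chosen afterwards
  -- to make $V$ small enough for the Neumann series.
  set B : ℝ≥0∞ := 3 ^ q * (C * (7 ^ d) ^ q) * (1 + C * (2 ^ d) ^ q * 2 ^ d + C) with hB
  set R : ℝ≥0∞ := K * B ^ (1 / q) with hR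
  have hCt := hW.const_ne_top
  have hrt : ∀ a : ℝ≥0∞, a ≠ ∞ → a ^ q ≠ ∞ := fun a ha => ENNReal.rpow_ne_top_of_nonneg hq0.le ha
  have hpt : ∀ n : ℕ, ((n : ℝ≥0∞) ^ d) ≠ ∞ := fun n =>
    ENNReal.pow_ne_top (ENNReal.natCast_ne_top _)
  have hBt : B ≠ ∞ := by
    have h2 := hpt 2
    have h7 := hpt 7
    push_cast at h2 h7
    refine ENNReal.mul_ne_top (ENNReal.mul_ne_top (hrt _ (by norm_num))
      (ENNReal.mul_ne_top hCt (hrt _ h7))) (ENNReal.add_ne_top.2 ⟨ENNReal.add_ne_top.2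
      ⟨by norm_num, ENNReal.mul_ne_top (ENNReal.mul_ne_top hCt (hrt _ h2)) h2⟩, hCt⟩)
  have hRt : R ≠ ∞ := ENNReal.mul_ne_top hK (ENNReal.rpow_ne_top_of_nonneg (by positivity) hBt)
  have hEt : (2 * 4 ^ d * (R * (7 ^ d + 10 ^ d)) : ℝ≥0∞) ≠ ∞ := by
    have h4 := hpt 4
    have h7 := hpt 7
    have h10 := hpt 10
    push_cast at h4 h7 h10
    exact ENNReal.mul_ne_top (ENNReal.mul_ne_top (by norm_num) h4)
      (ENNReal.mul_ne_top hRt (ENNReal.add_ne_top.2 ⟨h7, h10⟩))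
  obtain ⟨N, hN, hsmall⟩ := exists_radialSum_dampedProfile_le hd (antitone_radialProfile A) hS.ne
    (ε := 2⁻¹ / (2 * 4 ^ d * (R * (7 ^ d + 10 ^ d)))) (ENNReal.div_ne_zero.2 ⟨by simp, hEt⟩)
  set h := dampedProfile (radialProfile A) N with hh
  have hanti : Antitone h := antitone_dampedProfile _ _
  have hht : radialSum d h ≠ ∞ :=
    ne_top_of_le_ne_top hS.ne (radialSum_mono (dampedProfile_le (antitone_radialProfile A) N))
  obtain ⟨P, hPa, hPs, hP⟩ := exists_le_radialConv_of_le_add (d := d)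
    (V := fun n => R * commutatorProfile d h N n) (D := fun n => R * radialInd 2 n)
    (fun a b hab => mul_le_mul_right (antitone_commutatorProfile hanti N hab) _)
    (fun a b hab => mul_le_mul_right (antitone_radialInd 2 hab) _)
    (by
      rw [radialSum_const_mul]
      calc 2 * 4 ^ d * (R * radialSum d (commutatorProfile d h N))
          ≤ 2 * 4 ^ d * (R * ((7 ^ d + 10 ^ d) *
              (2⁻¹ / (2 * 4 ^ d * (R * (7 ^ d + 10 ^ d)))))) := by
            gcongr
            refine (radialSum_commutatorProfile_le hN hanti).trans ?_
            gcongr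
        _ = 2 * 4 ^ d * (R * (7 ^ d + 10 ^ d)) *
              (2⁻¹ / (2 * 4 ^ d * (R * (7 ^ d + 10 ^ d)))) := by ring
        _ ≤ _ := ENNReal.mul_div_le)
    (by
      rw [radialSum_const_mul, radialSum_radialInd]
      have h5 := hpt 5
      push_cast at h5
      rw [show 2 * ((2 : ℕ) : ℝ≥0∞) + 1 = 5 by norm_num]
      exact ENNReal.mul_lt_top hRt.lt_top h5.lt_top)
  set T : ℝ≥0∞ := C ^ (1 / q) * (N : ℝ≥0∞) ^ d with hT
  have hTt : T ≠ ∞ := ENNReal.mul_ne_top (ENNReal.rpow_ne_top_of_nonneg (by positivity) hCt) (hpt N)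
  refine ⟨fun n => T * P (n / N), fun a b hab => mul_le_mul_right (hPa (Nat.div_le_div_right hab)) _,
    ?_, ?_⟩
  · rw [radialSum_const_mul]
    refine ENNReal.mul_lt_top hTt.lt_top ((radialSum_comp_div_le P hN).trans_lt ?_)
    have h2N := hpt (2 * N)
    push_cast at h2N
    exact ENNReal.mul_lt_top h2N.lt_top hPs
  intro c M hM hc i
  have hblock : ∀ m, blockMean q W N (fun i => ‖c i‖ₑ) m ≤
      radialConv P (blockMean q W N fun i => ‖mulSeq A c i‖ₑ) m := by
    refine hP _ _ M hM.lt_top (fun m => blockMean_le_of_le hW fun i _ => hc i) fun m => ?_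
    have hE := energy_le_of_le_commutator hd hW hN hanti hht m (fun i => ‖c i‖ₑ)
      (fun i => ‖mulSeq A c i‖ₑ) _ (enorm_mulSeq_cutoff_le hS.ne hN m hM hc)
    set Tot := radialConv (radialInd 2) (blockMean q W N fun i => ‖mulSeq A c i‖ₑ) m +
        radialConv (commutatorProfile d h N) (blockMean q W N fun i => ‖c i‖ₑ) m with hTot
    rw [← hB] at hE
    -- The merely bounded $c$ need not lie in $\ell^q_w$, but its cut-off version has finite
    -- support, so stability applies.
    have hfin : energy q W (fun i => ‖(cutoff N m i : ℂ) * c i‖ₑ) < ∞ := by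
      refine energy_lt_top_of_finite_support hq0 hW.ne_top (fun i => enorm_ne_top)
        (latBall (fun t => N * m t) (4 * N)) fun i hi => ?_
      rw [mem_latBall, not_le] at hi
      have h1 := latNorm_sub_le_mul_blockIdx hN i (fun t => N * m t)
      rw [blockIdx_corner hN] at h1
      have h2 : ¬ latNorm (blockIdx N i - m) ≤ 2 := by
        intro h3
        have := Nat.mul_le_mul_left N h3
        omega
      simp [cutoff_eq_zero hN h2]
    have hs := hstab _ hfin
    have hlow : ∑ i ∈ block N m, ‖c i‖ₑ ^ q * W i ≤
        energy q W (fun i => ‖(cutoff N m i : ℂ) * c i‖ₑ) := by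
      refine le_trans (le_of_eq ?_) (ENNReal.sum_le_tsum (block N m))
      refine Finset.sum_congr rfl fun i hi => ?_
      simp [cutoff_eq_one hN hi]
    rw [sum_block_eq hW hN (fun i => ‖c i‖ₑ)] at hlow
    have h1 := hlow.trans (hs.trans (mul_le_mul_right hE _))
    have h2 : blockMean q W N (fun i => ‖c i‖ₑ) m ^ q ≤ K ^ q * (B * Tot ^ q) := by
      rw [← ENNReal.mul_le_mul_iff_left (hW.sum_block_ne_zero hN m) (hW.sum_ne_top _)]
      refine h1.trans (le_of_eq ?_)
      ring
    have h3 := ENNReal.rpow_le_rpow h2 (show 0 ≤ 1 / q by positivity)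
    rw [ENNReal.mul_rpow_of_nonneg _ _ (by positivity),
      ENNReal.mul_rpow_of_nonneg _ _ (by positivity), ← ENNReal.rpow_mul, ← ENNReal.rpow_mul,
      ← ENNReal.rpow_mul, mul_one_div_cancel hq0.ne', ENNReal.rpow_one, ENNReal.rpow_one,
      ENNReal.rpow_one, ← mul_assoc, ← hR] at h3
    refine h3.trans (le_of_eq ?_)
    rw [hTot, mul_add]
    simp only [radialConv, mul_assoc, ENNReal.tsum_mul_left]
  -- The weight is eliminated here: on the left through the cube condition, which costs `T`, and on
  -- the right by bounding a mean by the maximum over the cube, hence by the sum.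
  calc ‖c i‖ₑ ≤ ∑ j ∈ block N (blockIdx N i), ‖c j‖ₑ :=
        Finset.single_le_sum (f := fun j => ‖c j‖ₑ) (fun _ _ => zero_le) ((mem_block hN).2 rfl)
    _ ≤ T * blockMean q W N (fun i => ‖c i‖ₑ) (blockIdx N i) := by
        rw [hT, mul_assoc]
        exact sum_block_le_blockMean hW hN _ _
    _ ≤ T * ∑' l, P (latNorm (blockIdx N i - l)) * ∑ j ∈ block N l, ‖mulSeq A c j‖ₑ := by
        refine mul_le_mul_right ((hblock _).trans (ENNReal.tsum_le_tsum fun l =>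
          mul_le_mul_right (blockMean_le_of_le hW fun j hj => ?_) _)) _
        exact Finset.single_le_sum (f := fun j => ‖mulSeq A c j‖ₑ) (fun _ _ => zero_le) hj
    _ = ∑' l, ∑ j ∈ block N l, T * P (latNorm (blockIdx N i - blockIdx N j)) *
          ‖mulSeq A c j‖ₑ := by
        rw [← ENNReal.tsum_mul_left]
        refine tsum_congr fun l => ?_
        rw [Finset.mul_sum, Finset.mul_sum]
        refine Finset.sum_congr rfl fun j hj => ?_
        rw [(mem_block hN).1 hj]
        exact (mul_assoc _ _ _).symm
    _ = ∑' j, T * P (latNorm (blockIdx N i - blockIdx N j)) * ‖mulSeq A c j‖ₑ :=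
        (tsum_eq_tsum_sum_block hN _).symm
    _ ≤ _ := by
        refine ENNReal.tsum_le_tsum fun j => mul_le_mul_left (mul_le_mul_right (hPa ?_) _) _
        refine Nat.le_of_lt_succ ((Nat.div_lt_iff_lt_mul (by omega)).2 ?_)
        have := latNorm_sub_le_mul_blockIdx hN i j
        rw [Nat.succ_mul, mul_comm]
        omega

/-! ### From the pointwise bound to stability in every space -/

theorem radialConv_ne_top_of_energy (hd : 1 ≤ d) {q : ℝ} {W : Lat d → ℝ≥0∞} {C : ℝ≥0∞}
    (hW : IsCubeWeight q W C) {F : ℕ → ℝ≥0∞} (hF : Antitone F) (hS : radialSum d F ≠ ∞)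
    {x : Lat d → ℝ≥0∞} (hx : energy q W x ≠ ∞) (i : Lat d) : radialConv F x i ≠ ∞ := by
  have hq : 0 < q := zero_lt_one.trans_le hW.one_le
  have h2 : (2 : ℝ≥0∞) ^ d ≠ ∞ := ENNReal.pow_ne_top (by norm_num)
  have h1 : radialConv F x i ^ q * W i ≠ ∞ :=
    ne_top_of_le_ne_top (ENNReal.mul_ne_top (ENNReal.mul_ne_top (ENNReal.mul_ne_top
      (ENNReal.mul_ne_top hW.const_ne_top (ENNReal.rpow_ne_top_of_nonneg hq.le h2)) h2)
      (ENNReal.rpow_ne_top_of_nonneg hq.le hS)) hx)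
      ((ENNReal.le_tsum i).trans (energy_radialConv_le hd hW hF hS x))
  intro h
  rw [h, ENNReal.top_rpow_of_pos hq, ENNReal.top_mul (hW.ne_zero i)] at h1
  exact h1 rfl

/-- A pointwise bound by radially decreasing kernels on bounded sequences implies a lower
bound in every weighted `ℓ^q`. -/
theorem energy_le_of_radial_majorant (hd : 1 ≤ d) {A : InfMatrix d}
    (hS : radialSum d (radialProfile A) < ∞) {G : ℕ → ℝ≥0∞} (hG : Antitone G)
    (hGs : radialSum d G < ∞)
    (hmaj : ∀ (c : Lat d → ℂ) (M : ℝ≥0∞), M ≠ ∞ → (∀ i, ‖c i‖ₑ ≤ M) →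
        ∀ i, ‖c i‖ₑ ≤ radialConv G (fun j => ‖mulSeq A c j‖ₑ) i)
    {q : ℝ} {W : Lat d → ℝ≥0∞} {C : ℝ≥0∞} (hW : IsCubeWeight q W C) :
    ∃ K : ℝ≥0∞, K ≠ ∞ ∧ ∀ c : Lat d → ℂ, energy q W (fun i => ‖c i‖ₑ) ≠ ∞ →
      energy q W (fun i => ‖c i‖ₑ) ≤ K * energy q W (fun i => ‖mulSeq A c i‖ₑ) := by
  have hq : 0 < q := zero_lt_one.trans_le hW.one_le
  set F := radialProfile A with hFdef
  have hF : Antitone F := antitone_radialProfile A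
  have h2 : (2 : ℝ≥0∞) ^ d ≠ ∞ := ENNReal.pow_ne_top (by norm_num)
  set KG := C * (2 ^ d) ^ q * 2 ^ d * radialSum d G ^ q with hKG
  set KF := C * (2 ^ d) ^ q * 2 ^ d * radialSum d F ^ q with hKF
  have hfin : ∀ s : ℝ≥0∞, s < ∞ → C * (2 ^ d) ^ q * 2 ^ d * s ^ q ≠ ∞ := fun s hs =>
    ENNReal.mul_ne_top (ENNReal.mul_ne_top (ENNReal.mul_ne_top hW.const_ne_top
      (ENNReal.rpow_ne_top_of_nonneg hq.le h2)) h2) (ENNReal.rpow_ne_top_of_nonneg hq.le hs.ne)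
  have h3 : (3 : ℝ≥0∞) ^ q ≠ ∞ := ENNReal.rpow_ne_top_of_nonneg hq.le (by norm_num)
  refine ⟨KG * 3 ^ q, ENNReal.mul_ne_top (hfin _ hGs) h3, fun c hc => ?_⟩
  have hsum : ∀ i, Summable fun j => A i j * c j := fun i =>
    summable_mul_of_radialConv_ne_top (radialConv_ne_top_of_energy hd hW hF hS.ne hc i)
  -- A sequence in the weighted space may be unbounded, so the majorant is applied to its
  -- restriction $c_1$ to a finite set. Since $Ac_1=Ac-Ac_2$, the error is controlled by the energy
  -- of the tail $c_2$, which tends to zero as the set grows.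
  have hbound : ∀ s : Finset (Lat d), ∑ i ∈ s, ‖c i‖ₑ ^ q * W i ≤
      KG * (3 ^ q * (energy q W (fun i => ‖mulSeq A c i‖ₑ) +
        KF * ∑' i : {i // i ∉ s}, ‖c i.1‖ₑ ^ q * W i.1)) := by
    intro s
    set c₁ : Lat d → ℂ := fun i => if i ∈ s then c i else 0 with hc₁
    set c₂ : Lat d → ℂ := fun i => if i ∈ s then 0 else c i with hc₂
    have hle₁ : ∀ i, ‖c₁ i‖ₑ ≤ ‖c i‖ₑ := fun i => by
      rw [hc₁]
      dsimp only
      split_ifs <;> simp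
    have hle₂ : ∀ i, ‖c₂ i‖ₑ ≤ ‖c i‖ₑ := fun i => by
      rw [hc₂]
      dsimp only
      split_ifs <;> simp
    have hE₂ : energy q W (fun i => ‖c₂ i‖ₑ) = ∑' i : {i // i ∉ s}, ‖c i.1‖ₑ ^ q * W i.1 := by
      have := tsum_subtype {i | i ∉ s} fun i => ‖c i‖ₑ ^ q * W i
      refine Eq.trans (tsum_congr fun i => ?_) this.symm
      rw [hc₂]
      by_cases hi : i ∈ s <;> simp [hi, hq]
    have hE₂t : energy q W (fun i => ‖c₂ i‖ₑ) ≠ ∞ := ne_top_of_le_ne_top hc (energy_mono hq.le hle₂)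
    have hsum₂ : ∀ i, Summable fun j => A i j * c₂ j := fun i =>
      summable_mul_of_radialConv_ne_top (radialConv_ne_top_of_energy hd hW hF hS.ne hE₂t i)
    have hmul : ∀ i, mulSeq A c₁ i = mulSeq A c i - mulSeq A c₂ i := by
      intro i
      rw [mulSeq, mulSeq, mulSeq, ← (hsum i).tsum_sub (hsum₂ i)]
      refine tsum_congr fun j => ?_
      rw [hc₁, hc₂]
      dsimp only
      split_ifs <;> ring
    have hc₁b : ∀ i, ‖c₁ i‖ₑ ≤ ∑ j ∈ s, ‖c j‖ₑ := fun i => by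
      by_cases hi : i ∈ s
      · exact (hle₁ i).trans (Finset.single_le_sum (f := fun j => ‖c j‖ₑ) (fun _ _ => zero_le) hi)
      · simp [hc₁, hi]
    have hm := hmaj c₁ _ (by simp [ENNReal.sum_eq_top]) hc₁b
    calc ∑ i ∈ s, ‖c i‖ₑ ^ q * W i = ∑ i ∈ s, ‖c₁ i‖ₑ ^ q * W i :=
          Finset.sum_congr rfl fun i hi => by simp [hc₁, hi]
      _ ≤ energy q W (fun i => ‖c₁ i‖ₑ) := ENNReal.sum_le_tsum s
      _ ≤ energy q W (radialConv G fun j => ‖mulSeq A c₁ j‖ₑ) := energy_mono hq.le hm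
      _ ≤ KG * energy q W (fun j => ‖mulSeq A c₁ j‖ₑ) := energy_radialConv_le hd hW hG hGs.ne _
      _ ≤ KG * (3 ^ q * (energy q W (fun i => ‖mulSeq A c i‖ₑ) +
            energy q W (fun i => ‖mulSeq A c₂ i‖ₑ))) := by
          gcongr
          rw [energy, energy, energy, ← ENNReal.tsum_add, ← ENNReal.tsum_mul_left]
          refine ENNReal.tsum_le_tsum fun i => ?_
          rw [← add_mul, ← mul_assoc]
          gcongr
          have h1 : ‖mulSeq A c₁ i‖ₑ ≤ ‖mulSeq A c i‖ₑ + ‖mulSeq A c₂ i‖ₑ + 0 := by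
            rw [hmul, add_zero]
            exact enorm_sub_le
          refine (ENNReal.rpow_le_rpow h1 hq.le).trans ((add_add_rpow_le hq.le _ _ _).trans ?_)
          simp [hq]
      _ ≤ KG * (3 ^ q * (energy q W (fun i => ‖mulSeq A c i‖ₑ) +
            KF * energy q W (fun i => ‖c₂ i‖ₑ))) := by
          gcongr
          exact (energy_mono hq.le (enorm_mulSeq_le A c₂)).trans
            (energy_radialConv_le hd hW hF hS.ne _)
      _ = _ := by rw [hE₂]
  have htail := ENNReal.tendsto_tsum_compl_atTop_zero (f := fun i => ‖c i‖ₑ ^ q * W i) hc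
  have hlim : Filter.Tendsto (fun s : Finset (Lat d) =>
      KG * (3 ^ q * (energy q W (fun i => ‖mulSeq A c i‖ₑ) +
        KF * ∑' i : {i // i ∉ s}, ‖c i.1‖ₑ ^ q * W i.1))) Filter.atTop
      (nhds (KG * (3 ^ q * (energy q W (fun i => ‖mulSeq A c i‖ₑ) + KF * 0)))) :=
    ENNReal.Tendsto.const_mul (ENNReal.Tendsto.const_mul (Filter.Tendsto.const_add _
      (ENNReal.Tendsto.const_mul htail (Or.inr (hfin _ hS)))) (Or.inr h3)) (Or.inr (hfin _ hGs))
  have := le_of_tendsto_of_tendsto (ENNReal.summable (f := fun i => ‖c i‖ₑ ^ q * W i)).hasSum hlim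
    (Filter.Eventually.of_forall hbound)
  rw [mul_zero, add_zero, ← mul_assoc] at this
  exact this

theorem hasStability_of_radial_majorant (hd : 1 ≤ d) {A : InfMatrix d}
    (hS : radialSum d (radialProfile A) < ∞) {G : ℕ → ℝ≥0∞} (hG : Antitone G)
    (hGs : radialSum d G < ∞)
    (hmaj : ∀ (c : Lat d → ℂ) (M : ℝ≥0∞), M ≠ ∞ → (∀ i, ‖c i‖ₑ ≤ M) →
        ∀ i, ‖c i‖ₑ ≤ radialConv G (fun j => ‖mulSeq A c j‖ₑ) i)
    {q : ℝ} (hq : 1 ≤ q) {w : Lat d → ℝ} (hw : IsDiscreteAq q w) : HasStability A q w := by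
  have hq0 : 0 < q := by linarith
  obtain ⟨C, hW⟩ := hw.exists_isCubeWeight hq
  obtain ⟨K, hK, hlow⟩ := energy_le_of_radial_majorant hd hS hG hGs hmaj hW
  have hF : Antitone (radialProfile A) := antitone_radialProfile A
  have h2 : (2 : ℝ≥0∞) ^ d ≠ ∞ := ENNReal.pow_ne_top (by norm_num)
  set L := C * (2 ^ d) ^ q * 2 ^ d * radialSum d (radialProfile A) ^ q with hL
  have hLt : L ≠ ∞ :=
    ENNReal.mul_ne_top (ENNReal.mul_ne_top (ENNReal.mul_ne_top hW.const_ne_top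
      (ENNReal.rpow_ne_top_of_nonneg hq0.le h2)) h2) (ENNReal.rpow_ne_top_of_nonneg hq0.le hS.ne)
  have hq1 : 0 ≤ 1 / q := by positivity
  lift K to ℝ≥0 using hK
  lift L to ℝ≥0 using hLt with L' hL'
  -- The $1$ only ensures positivity of the stability constant.
  set B : ℝ≥0 := max 1 (max (K ^ (1 / q)) (L' ^ (1 / q))) with hB
  have hB0 : 0 < B := lt_of_lt_of_le zero_lt_one (le_max_left _ _)
  refine ⟨B, hB0, fun c hc => ?_⟩
  have hc' := (weightedNorm_lt_top_iff hq w c).1 hc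
  refine ⟨fun i => summable_mul_of_radialConv_ne_top
    (radialConv_ne_top_of_energy hd hW hF hS.ne hc'.ne i), ?_, ?_⟩
  · rw [ENNReal.coe_inv hB0.ne', ENNReal.inv_mul_le_iff (by simpa using hB0.ne') ENNReal.coe_ne_top,
      weightedNorm_eq hq0.le, weightedNorm_eq hq0.le]
    refine (ENNReal.rpow_le_rpow (hlow c hc'.ne) hq1).trans ?_
    rw [ENNReal.mul_rpow_of_nonneg _ _ hq1, ← ENNReal.coe_rpow_of_nonneg _ hq1]
    gcongr
    exact (le_max_left _ _).trans (le_max_right _ _)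
  · rw [weightedNorm_eq hq0.le, weightedNorm_eq hq0.le]
    have hup : energy q (fun i => ENNReal.ofReal (w i)) (fun i => ‖mulSeq A c i‖ₑ) ≤
        L' * energy q (fun i => ENNReal.ofReal (w i)) (fun i => ‖c i‖ₑ) := by
      rw [hL']
      exact (energy_mono hq0.le (enorm_mulSeq_le A c)).trans
        (energy_radialConv_le hd hW hF hS.ne _)
    refine (ENNReal.rpow_le_rpow hup hq1).trans ?_
    rw [ENNReal.mul_rpow_of_nonneg _ _ hq1, ← ENNReal.coe_rpow_of_nonneg _ hq1]
    gcongr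
    exact (le_max_right _ _).trans (le_max_right _ _)

end BeurlingStability

end

theorem mainTheorem2 (d : ℕ) (hd : 1 ≤ d) (p : ENNReal) (hp : 1 ≤ p)
    (u : BeurlingStability.Lat d → BeurlingStability.Lat d → ℝ)
    (hu : BeurlingStability.IsSubmultiplicative p u)
    (A : BeurlingStability.InfMatrix d) (hA : A ∈ BeurlingStability.beurlingClass p u)
    (q : ℝ) (hq : 1 ≤ q) (w : BeurlingStability.Lat d → ℝ)
    (hw : BeurlingStability.IsDiscreteAq q w)
    (hstab : BeurlingStability.HasStability A q w) :
    (∀ q' : ℝ, 1 ≤ q' → ∀ w' : BeurlingStability.Lat d → ℝ,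
      BeurlingStability.IsDiscreteAq q' w' → BeurlingStability.HasStability A q' w') ∧
    (∃ g : BeurlingStability.Lat d → ℝ,
      (∀ i, 0 ≤ g i) ∧ (∀ i j, ‖i‖ ≤ ‖j‖ → g j ≤ g i) ∧ Summable g ∧
      ∀ c : BeurlingStability.Lat d → ℂ, (∃ M : ℝ, ∀ i, ‖c i‖ ≤ M) →
        ∀ i, (Summable fun j => A i j * c j) ∧
          (Summable fun j => g (i - j) * ‖BeurlingStability.mulSeq A c j‖) ∧
          ‖c i‖ ≤ ∑' j, g (i - j) * ‖BeurlingStability.mulSeq A c j‖) := by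
  open BeurlingStability in
  have hS := radialSum_radialProfile_lt_top hp hu hA
  obtain ⟨G, hG, hGs, hmaj⟩ := hstab.exists_radial_majorant hd hS hq hw
  have hGt : ∀ n, G n ≠ ∞ := fun n =>
    ne_top_of_le_ne_top hGs.ne (le_radialSum_of_antitone hG n)
  refine ⟨fun q' hq' w' hw' => hasStability_of_radial_majorant hd hS hG hGs hmaj hq' hw',
    fun i => (G (latNorm i)).toReal, fun i => ENNReal.toReal_nonneg, fun i j hij => ?_,
    ENNReal.summable_toReal hGs.ne, ?_⟩
  · rw [norm_eq_latNorm, norm_eq_latNorm, Nat.cast_le] at hij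
    exact ENNReal.toReal_mono (hGt _) (hG hij)
  · rintro c ⟨M, hM⟩ i
    have hcM : ∀ i, ‖c i‖ₑ ≤ ENNReal.ofReal M := fun i => by
      rw [← ofReal_norm]
      exact ENNReal.ofReal_le_ofReal (hM i)
    have hconv := fun i => radialConv_ne_top_of_le hS.ne ENNReal.ofReal_ne_top hcM i
    have hAc : ∀ j, ‖mulSeq A c j‖ₑ ≤
        radialSum d (radialProfile A) * ENNReal.ofReal M := fun j => by
      refine (enorm_mulSeq_le A c j).trans ?_
      rw [← radialConv_const (radialProfile A) _ j]
      exact radialConv_mono (fun _ => le_rfl) hcM j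
    have hfin : radialConv G (fun j => ‖mulSeq A c j‖ₑ) i ≠ ∞ :=
      radialConv_ne_top_of_le hGs.ne (ENNReal.mul_ne_top hS.ne ENNReal.ofReal_ne_top) hAc i
    have hterm : ∀ j, (G (latNorm (i - j)) * ‖mulSeq A c j‖ₑ).toReal =
        (G (latNorm (i - j))).toReal * ‖mulSeq A c j‖ := fun j => by
      rw [ENNReal.toReal_mul, toReal_enorm]
    refine ⟨summable_mul_of_radialConv_ne_top (hconv i), ?_, ?_⟩
    · simp only [← hterm]
      exact ENNReal.summable_toReal hfin
    · have h1 := ENNReal.toReal_mono hfin (hmaj c _ ENNReal.ofReal_ne_top hcM i)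
      rw [toReal_enorm, radialConv, ENNReal.tsum_toReal_eq fun j =>
        ENNReal.mul_ne_top (hGt _) enorm_ne_top] at h1
      simpa only [hterm] using h1
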